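/- **Theorem.** Let $p,q\ge 1$ be fixed. There is a polynomial $P$, depending only on $p$ and $q$, such that for all $m\ge p$, $n\ge q$ and every integer matrix $A$ of size $m'\times n'$, $m'=m-p+1$, $n'=n-q+1$, with entries in $\{0,\dots,pq\}$ (in particular for every matrix that is the $(p,q)$-rectangular scan of a binary $m\times n$ matrix), the algorithm Reconstruction$(A,p,q)$ below halts, whether with a matrix or with FAILURE, after at most $P(mn)$ elementary steps. A step is one integer operation, comparison, reading or writing of an array cell, append to a sequence, or loop iteration; creating or copying an $h\times w$ array costs $hw+1$ steps. *Notation.* $R(M)[i,j]=\sum_{r<p}\sum_{c<q}M[i+r,j+c]$ is the $(p,q)$-rectangular scan of an $m\times n$ matrix $M$, and $X[i,j]=A[i,j]+A[i+1,j+1]-A[i+1,j]-A[i,j+1]$. For $1\le a\le p$, $1\le b\le q$, a valuation of the $(a,b)$-subgrid of $X$ is a binary $m\times n$ matrix $V$, zero outside the positions $(a+(i-1)p,\,b+(j-1)q)$, with $V[r,c]+V[r+p,c+q]-V[r+p,c]-V[r,c+q]=X[r,c]$ at these positions; it is minimal if no row and no column of this subgrid of $V$ is filled with $1$. *Reconstruction$(A,p,q)$.*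 (1) For each $(a,b)$ list the minimal valuations of the $(a,b)$-subgrid of $X$, adding the points of the subgrid column after column: a list of the minimal valuations of the first $j$ columns is kept, and each is extended to column $j+1$ in every minimal way (a zero row may be changed to a row of $1$'s followed by a $0$). (2) Form all sums $M_1,\dots,M_v$ of one element of each of the $pq$ lists. (3) For each $t$, compute $A_t=A-R(M_t)$, run RecSmoothAll$(A_t,p,q)$, and try to merge $M_t$ with each matrix of its output; return the first merged matrix. (4) If there is none, return FAILURE. *RecSmoothAll$(B,p,q)$.* Let $k=\min B$. Set $B_r=0$, $B_c=B-k$; subtract from each row $i$ of $B_c$ its minimum $k_i$ and put $k_i$ in row $i$ of $B_r$. If $B_c$ does not then have constant columns, the output is empty. Otherwise, for each $0\le t\le k$: - Put $R=B_r+t$, $C=B_c+k-t$. From $R$ compute a vector $e\in\mathbb Z^m$, initially $0$, while filling $e[i]$ cells of row $i$ of an auxiliary matrix: for $i=1,\dots,m'-1$ let $d=R[i,1]-R[i+1,1]$; if $d\le e[i]$ set $e[i+p]=e[i]-d$, otherwise increase $e[i']$ by $d-e[i]$ (the value of $e[i]$ before this step) for all $i'\le i$, $i'\equiv i \pmod p$.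 Let $k_{row}=R[1,1]-e[1]-\dots-e[p]$. Skip this $t$ if an entry set exceeds $q$ or if $k_{row}<0$. From $C$ compute $f\in\mathbb Z^n$ and $k_{col}$ in the same way with rows and columns exchanged. - List all $p\times q$ matrices $W$ over the symbols $0,P,Q,1_P^{(1)},\dots,1_P^{(k_{col})},1_Q^{(1)},\dots,1_Q^{(k_{row})}$ having $\max_{i'\equiv i\,(p)}e[i']$ symbols $Q$ in row $i$ and $\max_{j'\equiv j\,(q)}f[j']$ symbols $P$ in column $j$, and such that each $1_P^{(x)}$ (each $1_Q^{(y)}$) occurs and all its occurrences lie in one column (one row). - For each $W$ output the $m\times n$ matrix obtained as follows: in row $i$, put $Q$ at the first $e[i]$ columns $j\le q$ with $W[i \bmod p,j]=Q$; in column $j$, put $P$ at the first $f[j]$ rows $i\le p$ with $W[i,j\bmod q]=P$ (residues taken in $\{1,\dots,p\}$, $\{1,\dots,q\}$); copy the remaining symbols of $W$ into the upper left $p\times q$ block; then extend the symbols $Q$ with period $q$ along rows, the symbols $P$ with period $p$ along columns, and the symbols $1_P^{(x)},1_Q^{(y)}$ with both periods. *Merging $M$ with a matrix $N$ of symbols.*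 Scan the positions $(i,j)$ row by row. At $P$ or $Q$: if $M[i,j]=1$ the merge fails, otherwise set $M[i,j]=1$. At $s=1_P^{(x)}$: if $M[i',j]=0$ for all $i'\equiv i\pmod p$, set all these entries to $1$ and erase (set to $0$) all symbols $s$ in column $j$ of $N$; otherwise erase $N[i',j]$ for these $i'$, and the merge fails if no $s$ is left in column $j$. At $1_Q^{(y)}$ proceed symmetrically along row $i$. -/

import Mathlib

namespace Microscope

/-! ## The cost model

A computation yields a value together with the number of elementary steps used to obtain it.
The primitives of this section are the only source of steps, and every procedure below
is a composition of them: reading or writing one array cell, one integer operation, one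
comparison, one append to a sequence, and one loop iteration each cost one step, while creating or
copying an `h × w` array costs `h * w + 1` steps. Handing on a value already computed (in a tuple,
as a loop bound, or to a case distinction) is not charged. A procedure that modifies an array
which is still needed copies it first. Matrices are arrays addressed from `1`. -/

/-- A value together with the number of elementary steps spent to compute it. -/
structure Timed (α : Type) where
  val : α
  time : ℕ

instance : Monad Timed where
  pure a := ⟨a, 0⟩
  bind x f := ⟨(f x.val).val, x.time + (f x.val).time⟩

/-- A two-dimensional array, as a map from positions to contents. -/
abbrev Mat (α : Type) := ℕ → ℕ → α

/-- A one-dimensional array of integers. -/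
abbrev Vec := ℕ → ℤ

def add {α : Type} [Add α] (x y : α) : Timed α := ⟨x + y, 1⟩

def sub {α : Type} [Sub α] (x y : α) : Timed α := ⟨x - y, 1⟩

def mul (x y : ℕ) : Timed ℕ := ⟨x * y, 1⟩

def quo (x y : ℕ) : Timed ℕ := ⟨x / y, 1⟩

def rem (x y : ℕ) : Timed ℕ := ⟨x % y, 1⟩

/-- The comparison `x ≤ y`. -/
def leq (x y : ℤ) : Timed Bool := ⟨decide (x ≤ y), 1⟩

/-- The comparison `x = y`. -/
def same {α : Type} [DecidableEq α] (x y : α) : Timed Bool := ⟨decide (x = y), 1⟩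

/-- Create an `h × w` array all of whose cells hold `x`. -/
def alloc {α : Type} (h w : ℕ) (x : α) : Timed (Mat α) := ⟨fun _ _ => x, h * w + 1⟩

/-- Copy an `h × w` array. -/
def copy {α : Type} (h w : ℕ) (M : Mat α) : Timed (Mat α) := ⟨M, h * w + 1⟩

def rd {α : Type} (M : Mat α) (i j : ℕ) : Timed α := ⟨M i j, 1⟩

def wr {α : Type} (M : Mat α) (i j : ℕ) (x : α) : Timed (Mat α) :=
  ⟨fun r c => if r = i ∧ c = j then x else M r c, 1⟩

/-- Create a vector of `l` zeros. -/
def allocV (l : ℕ) : Timed Vec := ⟨fun _ => 0, l + 1⟩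

/-- Copy a vector of length `l`. -/
def copyV (l : ℕ) (v : Vec) : Timed Vec := ⟨v, l + 1⟩

def rdV (v : Vec) (i : ℕ) : Timed ℤ := ⟨v i, 1⟩

def wrV (v : Vec) (i : ℕ) (x : ℤ) : Timed Vec := ⟨fun r => if r = i then x else v r, 1⟩

/-- Append an element to a sequence. -/
def push {α : Type} (L : List α) (x : α) : Timed (List α) := ⟨L ++ [x], 1⟩

/-- One elementary step without effect: the overhead of one loop iteration. -/
def tick : Timed Unit := ⟨(), 1⟩

/-- Run through the sequence `L`, updating the state `s` by `body`. -/
def forEach {α σ : Type} (L : List α) (s : σ) (body : α → σ → Timed σ) : Timed σ :=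
  match L with
  | [] => do
      tick
      pure s
  | x :: xs => do
      tick
      let s' ← body x s
      forEach xs s' body

/-- The loop `for i = lo, lo + 1, …, hi`. -/
def forRange {σ : Type} (lo hi : ℕ) (s : σ) (body : ℕ → σ → Timed σ) : Timed σ :=
  forEach (List.range' lo (hi + 1 - lo)) s body

/-- Run through the sequence `L` until `f` succeeds; `none` if it never does. -/
def findFirst {α β : Type} (L : List α) (f : α → Timed (Option β)) : Timed (Option β) :=
  match L with
  | [] => do
      tick
      pure none
  | x :: xs => do
      tick
      match (← f x) with
      | some y => pure (some y)
      | none => findFirst xs f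

/-! ## Index arithmetic -/

/-- The representative in `{1, …, p}` of `i` modulo `p`. -/
def res (i p : ℕ) : Timed ℕ := do
  let x ← sub i 1
  let y ← rem x p
  add y 1

/-- The matrix index `a + (i - 1) p` of the `i`-th line of a subgrid starting at `a`. -/
def line (a p i : ℕ) : Timed ℕ := do
  let x ← sub i 1
  let y ← mul x p
  add a y

/-- The number of `i ≥ 1` with `a + (i - 1) p ≤ m` (for `1 ≤ a ≤ m`). -/
def lineCount (m a p : ℕ) : Timed ℕ := do
  let x ← sub m a
  let y ← quo x p
  add y 1

/-! ## Minimal valuations of the subgrids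

For a matrix `A` of size `m' × n'`, `chi A` is the `(m' - 1) × (n' - 1)` matrix `χ₁,₁(A)`.
A valuation of the `(a, b)`-subgrid of `X = χ₁,₁(A)` is a binary `m × n` matrix `V` which vanishes
outside the positions `(a + (i - 1) p, b + (j - 1) q)` and satisfies
`V[r,c] + V[r+p,c+q] - V[r+p,c] - V[r,c+q] = X[r,c]` on these positions.
It is minimal when no row and no column of its `(a, b)`-subgrid is filled with `1`. -/

/-- `χ₁,₁(A)[i,j] = A[i,j] + A[i+1,j+1] - A[i+1,j] - A[i,j+1]`. -/
def chi (m' n' : ℕ) (A : Mat ℤ) : Timed (Mat ℤ) := do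
  let X ← alloc m' n' (0 : ℤ)
  let h ← sub m' 1
  let w ← sub n' 1
  forRange 1 h X fun i X => forRange 1 w X fun j X => do
    let i1 ← add i 1
    let j1 ← add j 1
    let s ← add (← rd A i j) (← rd A i1 j1)
    let s ← sub s (← rd A i1 j)
    let s ← sub s (← rd A i j1)
    wr X i j s

/-- Are the first `j` entries of the subgrid row lying in row `r` of `V` all `0`? -/
def isZeroRow (b q j r : ℕ) (V : Mat ℤ) : Timed Bool :=
  forRange 1 j true fun c ok => do
    if (← same (← rd V r (← line b q c)) 0) then pure ok else pure false

/-- Is one of the first `j` columns of the `(a, b)`-subgrid of `V`, which has `h` rows,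
filled with `1`? -/
def hasFullColumn (a b p q h j : ℕ) (V : Mat ℤ) : Timed Bool :=
  forRange 1 j false fun c found => do
    let y ← line b q c
    let full ← forRange 1 h true fun i ok => do
      if (← same (← rd V (← line a p i) y) 1) then pure ok else pure false
    if full then pure true else pure found

/-- Extend the valuation `V` of the first `j` columns of the subgrid to column `j + 1`, by adding
the points in column `j` of the subgrid of `X`, so that the first
entry of column `j + 1` exceeds that of column `j` by `c`. A row that would receive `-1`
is first changed from `0` to `1` in its first `j` entries if these are all `0`, and otherwise
prevents the extension. Extensions that are not minimal are discarded. -/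
def extend (m n p q a b h j : ℕ) (X : Mat ℤ) (c : ℤ) (V : Mat ℤ) :
    Timed (Option (Mat ℤ)) := do
  let V ← copy m n V
  let y ← line b q j
  let y1 ← add y q
  let out ← forRange 1 h (some V, c) fun i st =>
    match st with
    | (none, d) => pure (none, d)
    | (some V, d) => do
      let x ← line a p i
      let v ← add (← rd V x y) d
      let d' ← if (← same i h) then pure d else add d (← rd X x y)
      if (← same v 0) then
        pure (some (← wr V x y1 0), d')
      else if (← same v 1) then
        pure (some (← wr V x y1 1), d')
      else if (← same v (-1)) then
        if (← isZeroRow b q j x V) then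
          let V ← forRange 1 j V fun c V => do wr V x (← line b q c) 1
          pure (some (← wr V x y1 0), d')
        else pure (none, d')
      else pure (none, d')
  match out.1 with
  | none => pure none
  | some V => do
    let j1 ← add j 1
    if (← hasFullColumn a b p q h j1 V) then pure none else pure (some V)

/-- The sequence of the minimal valuations of the `(a, b)`-subgrid of `X`, built up from the zero
matrix by adding the nonzero points of the subgrid from left to right. -/
def minimalValuations (m n p q a b : ℕ) (X : Mat ℤ) : Timed (List (Mat ℤ)) := do
  let h ← lineCount m a p
  let w ← lineCount n b q
  let w1 ← sub w 1
  let Z ← alloc m n (0 : ℤ)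
  let L ← push [] Z
  forRange 1 w1 L fun j L => forEach L [] fun V L' =>
    forEach [-1, 0, 1] L' fun c L' => do
      match (← extend m n p q a b h j X c V) with
      | none => pure L'
      | some V' => push L' V'

/-! ## Decomposition of a `(1,1)`-smooth matrix -/

/-- All decompositions `(A_r^t, A_c^t)`, `0 ≤ t ≤ k`, of the `m' × n'` matrix `A` into a
matrix with constant rows and a matrix with constant columns, `k` being the minimum of `A`;
the empty sequence stands for FAILURE. -/
def decompose (m' n' : ℕ) (A : Mat ℤ) : Timed (List (Mat ℤ × Mat ℤ)) := do
  let k ← forRange 1 m' (← rd A 1 1) fun i k => forRange 1 n' k fun j k => do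
    let x ← rd A i j
    if (← leq k x) then pure k else pure x
  let Ar ← alloc m' n' (0 : ℤ)
  let Ac ← alloc m' n' (0 : ℤ)
  let Ac ← forRange 1 m' Ac fun i Ac => forRange 1 n' Ac fun j Ac => do
    wr Ac i j (← sub (← rd A i j) k)
  let (Ar, Ac) ← forRange 1 m' (Ar, Ac) fun i st => do
    let ki ← forRange 1 n' (← rd st.2 i 1) fun j ki => do
      let x ← rd st.2 i j
      if (← leq ki x) then pure ki else pure x
    forRange 1 n' st fun j st => do
      let Ac ← wr st.2 i j (← sub (← rd st.2 i j) ki)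
      let Ar ← wr st.1 i j ki
      pure (Ar, Ac)
  let ok ← forRange 1 m' true fun i ok => forRange 1 n' ok fun j ok => do
    if (← same (← rd Ac i j) (← rd Ac 1 j)) then pure ok else pure false
  if ok then
    if (← leq 0 k) then
      forRange 0 k.toNat [] fun t L => do
        let Rt ← alloc m' n' (0 : ℤ)
        let Ct ← alloc m' n' (0 : ℤ)
        let kt ← sub k (t : ℤ)
        let (Rt, Ct) ← forRange 1 m' (Rt, Ct) fun i st => forRange 1 n' st fun j st => do
          let Rt ← wr st.1 i j (← add (← rd Ar i j) (t : ℤ))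
          let Ct ← wr st.2 i j (← add (← rd Ac i j) kt)
          pure (Rt, Ct)
        push L (Rt, Ct)
    else pure []
  else pure []

/-! ## First step of the reconstruction for constant rows or columns -/

/-- Write `1` in the cells `(i, lo), …, (i, hi)` of `M`. -/
def fillRow (i : ℕ) (lo hi : ℕ) (M : Mat ℤ) : Timed (Mat ℤ) :=
  forRange lo hi M fun c M => wr M i c 1

/-- The first step of RecConstRows on an `m' × n'` matrix `A` with constant rows: the partial
solution `M` (of size `(m'+p-1) × (n'+q-1)`), the vector `PEnt` counting the
entries `1` placed in each row of `M`, and the number `k = A[1,1] - PEnt[1] - ⋯ - PEnt[p]` of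
entries still to be placed in each window; `none` is FAILURE. -/
def recConstRows₁ (m' n' p q : ℕ) (A : Mat ℤ) : Timed (Option (Mat ℤ × Vec × ℤ)) := do
  let m ← sub (← add m' p) 1
  let n ← sub (← add n' q) 1
  let M ← alloc m n (0 : ℤ)
  let PEnt ← allocV m
  let l ← sub m' 1
  let out ← forRange 1 l (some (M, PEnt)) fun i st =>
    match st with
    | none => pure none
    | some (M, PEnt) => do
      let x ← rd A i 1
      let y ← rd A (← add i 1) 1
      let e ← rdV PEnt i
      let d ← sub x y
      let below : Timed (Option (Mat ℤ × Vec)) := do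
        let r ← add i p
        let len ← sub e d
        if (← leq len (q : ℤ)) then
          let M ← fillRow r 1 len.toNat M
          let PEnt ← wrV PEnt r len
          pure (some (M, PEnt))
        else pure none
      if (← leq x y) then below
      else if (← leq d e) then below
      else
        let k ← sub d e
        let c ← res i p
        forRange 1 i (some (M, PEnt)) fun i' st =>
          match st with
          | none => pure none
          | some (M, PEnt) => do
            if (← same (← res i' p) c) then
              let e' ← rdV PEnt i'
              let len ← add e' k
              if (← leq len (q : ℤ)) then
                let lo ← add e' 1
                let M ← fillRow i' lo.toNat len.toNat M
                let PEnt ← wrV PEnt i' len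
                pure (some (M, PEnt))
              else pure none
            else pure (some (M, PEnt))
  match out with
  | none => pure none
  | some (M, PEnt) => do
    let k ← forRange 1 p (← rd A 1 1) fun i k => do sub k (← rdV PEnt i)
    if (← leq 0 k) then pure (some (M, PEnt, k)) else pure none

/-- The transpose of an `h × w` matrix. -/
def transpose (h w : ℕ) (A : Mat ℤ) : Timed (Mat ℤ) := do
  let B ← alloc w h (0 : ℤ)
  forRange 1 h B fun i B => forRange 1 w B fun j B => do wr B j i (← rd A i j)

/-- The first step of RecConstCols: the same with the roles of rows and columns exchanged
(the partial solution is returned transposed). -/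
def recConstCols₁ (m' n' p q : ℕ) (A : Mat ℤ) : Timed (Option (Mat ℤ × Vec × ℤ)) := do
  let B ← transpose m' n' A
  recConstRows₁ n' m' q p B

/-- The vector `i ↦ max {PEnt[i'] : i' ≡ i mod p}`, `1 ≤ i ≤ p`, for `PEnt` of length `l`. -/
def classMax (l p : ℕ) (PEnt : Vec) : Timed Vec := do
  let v ← allocV p
  forRange 1 l v fun i v => do
    let r ← res i p
    let x ← rdV PEnt i
    if (← leq x (← rdV v r)) then pure v else wrV v r x

/-! ## Listing the solutions of the smooth part -/

/-- The symbols `0`, `P`, `Q`, `1_P^{(k)}`, `1_Q^{(k)}`. -/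
inductive Cell where
  | zero : Cell
  | P : Cell
  | Q : Cell
  | oneP : ℕ → Cell
  | oneQ : ℕ → Cell
deriving DecidableEq

/-- The symbols `0, P, Q, 1_P^{(1)}, …, 1_P^{(kcol)}, 1_Q^{(1)}, …, 1_Q^{(krow)}`. -/
def alphabet (krow kcol : ℕ) : Timed (List Cell) := do
  let L ← push [] Cell.zero
  let L ← push L Cell.P
  let L ← push L Cell.Q
  let L ← forRange 1 kcol L fun k L => push L (Cell.oneP k)
  forRange 1 krow L fun k L => push L (Cell.oneQ k)

/-- All `p × q` matrices with entries in `S`. -/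
def allWindows (p q : ℕ) (S : List Cell) : Timed (List (Mat Cell)) := do
  let W ← alloc p q Cell.zero
  let L ← push [] W
  forRange 1 p L fun i L => forRange 1 q L fun j L =>
    forEach L [] fun W acc => forEach S acc fun s acc => do
      let W ← copy p q W
      push acc (← wr W i j s)

/-- Does `W` have, for each row `i`, exactly `v[i]` entries `Q`? -/
def rowCountsOK (p q : ℕ) (v : Vec) (W : Mat Cell) : Timed Bool :=
  forRange 1 p true fun i ok => do
    let c ← forRange 1 q (0 : ℤ) fun j c => do
      if (← same (← rd W i j) Cell.Q) then add c 1 else pure c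
    if (← same c (← rdV v i)) then pure ok else pure false

/-- Does `W` have, for each column `j`, exactly `v[j]` entries `P`? -/
def colCountsOK (p q : ℕ) (v : Vec) (W : Mat Cell) : Timed Bool :=
  forRange 1 q true fun j ok => do
    let c ← forRange 1 p (0 : ℤ) fun i c => do
      if (← same (← rd W i j) Cell.P) then add c 1 else pure c
    if (← same c (← rdV v j)) then pure ok else pure false

/-- Does `s` occur in `W`, with all its occurrences in the same column? -/
def inOneColumn (p q : ℕ) (s : Cell) (W : Mat Cell) : Timed Bool := do
  let (col, ok) ← forRange 1 p (0, true) fun i st => forRange 1 q st fun j st => do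
    if (← same (← rd W i j) s) then
      if (← same st.1 0) then pure (j, st.2)
      else if (← same st.1 j) then pure st
      else pure (st.1, false)
    else pure st
  if (← same col 0) then pure false else pure ok

/-- Does `s` occur in `W`, with all its occurrences in the same row? -/
def inOneRow (p q : ℕ) (s : Cell) (W : Mat Cell) : Timed Bool := do
  let (row, ok) ← forRange 1 p (0, true) fun i st => forRange 1 q st fun j st => do
    if (← same (← rd W i j) s) then
      if (← same st.1 0) then pure (i, st.2)
      else if (← same st.1 i) then pure st
      else pure (st.1, false)
    else pure st
  if (← same row 0) then pure false else pure ok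

/-- The conditions on a `p × q` matrix of symbols: `rowMax[i]` entries `Q` in row `i`, `colMax[j]`
entries `P` in column `j`, each `1_P^{(k)}` occurs and lies in one column, each
`1_Q^{(k)}` occurs and lies in one row. -/
def admissible (p q krow kcol : ℕ) (rowMax colMax : Vec) (W : Mat Cell) : Timed Bool := do
  if (← rowCountsOK p q rowMax W) then
    if (← colCountsOK p q colMax W) then
      let ok ← forRange 1 kcol true fun k ok => do
        if (← inOneColumn p q (Cell.oneP k) W) then pure ok else pure false
      forRange 1 krow ok fun k ok => do
        if (← inOneRow p q (Cell.oneQ k) W) then pure ok else pure false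
    else pure false
  else pure false

/-- The `m × n` matrix of symbols determined by `W`: the entries `Q` and `P` of `W` are used
`rowEnt[i]` times in row `i` and `colEnt[j]` times in column `j`, the other symbols are copied, and
the result is extended by `(0,q)`-invariance of `Q`, `(p,0)`-invariance of `P`, and both
invariances of the symbols `1_P^{(k)}` and `1_Q^{(k)}`. -/
def expand (m n p q : ℕ) (rowEnt colEnt : Vec) (W : Mat Cell) : Timed (Mat Cell) := do
  let N ← alloc m n Cell.zero
  let rowEnt ← copyV m rowEnt
  let colEnt ← copyV n colEnt
  let (N, _) ← forRange 1 m (N, rowEnt) fun i st => forRange 1 q st fun j st => do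
    let e ← rdV st.2 i
    if (← same e 0) then pure st
    else if (← same (← rd W (← res i p) j) Cell.Q) then
      let N ← wr st.1 i j Cell.Q
      let v ← wrV st.2 i (← sub e 1)
      pure (N, v)
    else pure st
  let (N, _) ← forRange 1 n (N, colEnt) fun j st => forRange 1 p st fun i st => do
    let e ← rdV st.2 j
    if (← same e 0) then pure st
    else if (← same (← rd W i (← res j q)) Cell.P) then
      let N ← wr st.1 i j Cell.P
      let v ← wrV st.2 j (← sub e 1)
      pure (N, v)
    else pure st
  let N ← forRange 1 p N fun i N => forRange 1 q N fun j N => do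
    match (← rd W i j) with
    | Cell.P => pure N
    | Cell.Q => pure N
    | s => wr N i j s
  forRange 1 m N fun i N => forRange 1 n N fun j N => do
    let i' ← res i p
    let j' ← res j q
    if (← same (← rd N i j') Cell.Q) then wr N i j Cell.Q
    else if (← same (← rd N i' j) Cell.P) then wr N i j Cell.P
    else
      match (← rd N i' j') with
      | Cell.oneP k => wr N i j (Cell.oneP k)
      | Cell.oneQ k => wr N i j (Cell.oneQ k)
      | _ => pure N

/-- The procedure RecSmoothAll, for an `m' × n'` matrix `A`. -/
def recSmoothAll (m' n' p q : ℕ) (A : Mat ℤ) : Timed (List (Mat Cell)) := do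
  let m ← sub (← add m' p) 1
  let n ← sub (← add n' q) 1
  let D ← decompose m' n' A
  forEach D [] fun AA acc => do
    match (← recConstRows₁ m' n' p q AA.1) with
    | none => pure acc
    | some (_, rowEnt, krow) =>
      match (← recConstCols₁ m' n' p q AA.2) with
      | none => pure acc
      | some (_, colEnt, kcol) => do
        let rowMax ← classMax m p rowEnt
        let colMax ← classMax n q colEnt
        let S ← alphabet krow.toNat kcol.toNat
        let Ws ← allWindows p q S
        forEach Ws acc fun W acc => do
          if (← admissible p q krow.toNat kcol.toNat rowMax colMax W) then
            push acc (← expand m n p q rowEnt colEnt W)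
          else pure acc

/-! ## Merging -/

/-- Replace `s` by `0` in column `j`. -/
def clearColumn (m j : ℕ) (s : Cell) (N : Mat Cell) : Timed (Mat Cell) :=
  forRange 1 m N fun i N => do
    if (← same (← rd N i j) s) then wr N i j Cell.zero else pure N

/-- Replace `s` by `0` in row `i`. -/
def clearRow (n i : ℕ) (s : Cell) (N : Mat Cell) : Timed (Mat Cell) :=
  forRange 1 n N fun j N => do
    if (← same (← rd N i j) s) then wr N i j Cell.zero else pure N

/-- Does `s` occur in column `j`? -/
def occursInColumn (m j : ℕ) (s : Cell) (N : Mat Cell) : Timed Bool :=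
  forRange 1 m false fun i found => do
    if (← same (← rd N i j) s) then pure true else pure found

/-- Does `s` occur in row `i`? -/
def occursInRow (n i : ℕ) (s : Cell) (N : Mat Cell) : Timed Bool :=
  forRange 1 n false fun j found => do
    if (← same (← rd N i j) s) then pure true else pure found

/-- Are all the entries `(i', j)` with `i' ≡ i mod p` equal to `0`? -/
def columnFree (m p i j : ℕ) (M : Mat ℤ) : Timed Bool := do
  let r ← res i p
  forRange 1 m true fun i' ok => do
    if (← same (← res i' p) r) then
      if (← same (← rd M i' j) 0) then pure ok else pure false
    else pure ok

/-- Are all the entries `(i, j')` with `j' ≡ j mod q` equal to `0`? -/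
def rowFree (n q i j : ℕ) (M : Mat ℤ) : Timed Bool := do
  let r ← res j q
  forRange 1 n true fun j' ok => do
    if (← same (← res j' q) r) then
      if (← same (← rd M i j') 0) then pure ok else pure false
    else pure ok

/-- Write `x` in all the positions `(i', j)` with `i' ≡ i mod p`. -/
def setColumn {α : Type} (m p i j : ℕ) (x : α) (M : Mat α) : Timed (Mat α) := do
  let r ← res i p
  forRange 1 m M fun i' M => do
    if (← same (← res i' p) r) then wr M i' j x else pure M

/-- Write `x` in all the positions `(i, j')` with `j' ≡ j mod q`. -/
def setRow {α : Type} (n q i j : ℕ) (x : α) (M : Mat α) : Timed (Mat α) := do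
  let r ← res j q
  forRange 1 n M fun j' M => do
    if (← same (← res j' q) r) then wr M i j' x else pure M

/-- Merge the binary matrix `M` with the matrix of symbols `N`; `none` if a conflict occurs. -/
def merge (m n p q : ℕ) (M : Mat ℤ) (N : Mat Cell) : Timed (Option (Mat ℤ)) := do
  let M ← copy m n M
  let N ← copy m n N
  let out ← forRange 1 m (some (M, N)) fun i st => forRange 1 n st fun j st =>
    match st with
    | none => pure none
    | some (M, N) => do
      match (← rd N i j) with
      | Cell.zero => pure (some (M, N))
      | Cell.P | Cell.Q =>
        if (← same (← rd M i j) 1) then pure none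
        else pure (some (← wr M i j 1, N))
      | Cell.oneP k =>
        if (← columnFree m p i j M) then
          let M ← setColumn m p i j 1 M
          let N ← clearColumn m j (Cell.oneP k) N
          pure (some (M, N))
        else
          let N ← setColumn m p i j Cell.zero N
          if (← occursInColumn m j (Cell.oneP k) N) then pure (some (M, N)) else pure none
      | Cell.oneQ k =>
        if (← rowFree n q i j M) then
          let M ← setRow n q i j 1 M
          let N ← clearRow n i (Cell.oneQ k) N
          pure (some (M, N))
        else
          let N ← setRow n q i j Cell.zero N
          if (← occursInRow n i (Cell.oneQ k) N) then pure (some (M, N)) else pure none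
  match out with
  | none => pure none
  | some (M, _) => pure (some M)

/-! ## The reconstruction algorithm -/

/-- The sequences of minimal valuations of all the subgrids `(a, b)`, `1 ≤ a ≤ p`, `1 ≤ b ≤ q`. -/
def allValuations (m n p q : ℕ) (X : Mat ℤ) : Timed (List (List (Mat ℤ))) :=
  forRange 1 p [] fun a Ls => forRange 1 q Ls fun b Ls => do
    push Ls (← minimalValuations m n p q a b X)

/-- The sum of two `m × n` matrices. -/
def addMat (m n : ℕ) (M V : Mat ℤ) : Timed (Mat ℤ) := do
  let S ← alloc m n (0 : ℤ)
  forRange 1 m S fun i S => forRange 1 n S fun j S => do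
    wr S i j (← add (← rd M i j) (← rd V i j))

/-- All the sums of one element from each sequence. -/
def allSums (m n : ℕ) (Ls : List (List (Mat ℤ))) : Timed (List (Mat ℤ)) := do
  let Z ← alloc m n (0 : ℤ)
  let Ms ← push [] Z
  forEach Ls Ms fun L Ms => forEach Ms [] fun M acc => forEach L acc fun V acc => do
    push acc (← addMat m n M V)

/-- The matrix `A - R(M)`, where `R(M)` is the `(p,q)`-rectangular scan
`R(M)[i,j] = ∑_{r < p} ∑_{c < q} M[i+r,j+c]`. -/
def residual (m' n' p q : ℕ) (A M : Mat ℤ) : Timed (Mat ℤ) := do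
  let B ← alloc m' n' (0 : ℤ)
  let p1 ← sub p 1
  let q1 ← sub q 1
  forRange 1 m' B fun i B => forRange 1 n' B fun j B => do
    let s ← forRange 0 p1 (← rd A i j) fun r s => forRange 0 q1 s fun c s => do
      sub s (← rd M (← add i r) (← add j c))
    wr B i j s

/-- The algorithm Reconstruction(A, p, q) for an `m' × n'` matrix `A`. It returns a binary
matrix of size `(m' + p - 1) × (n' + q - 1)`, or `none` for FAILURE. -/
def reconstruction (m' n' p q : ℕ) (A : Mat ℤ) : Timed (Option (Mat ℤ)) := do
  let m ← sub (← add m' p) 1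
  let n ← sub (← add n' q) 1
  let X ← chi m' n' A
  let Ls ← allValuations m n p q X
  let Ms ← allSums m n Ls
  findFirst Ms fun M => do
    let B ← residual m' n' p q A M
    let Ns ← recSmoothAll m' n' p q B
    findFirst Ns fun N => merge m n p q M N

/-- The array, addressed from `1`, holding the entries of a matrix. -/
def toMat {h w : ℕ} (A : Matrix (Fin h) (Fin w) ℤ) : Mat ℤ := fun i j =>
  if hij : (1 ≤ i ∧ i ≤ h) ∧ (1 ≤ j ∧ j ≤ w) then
    A ⟨i - 1, by omega⟩ ⟨j - 1, by omega⟩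
  else 0

end Microscope

/-! Halting is built in, since every procedure is a composition of finite loops; only the number of
steps is at stake. Put N = mn. Loops over positions or lines run at most N times, so nesting them
costs a power of N. The danger lies in the lists the algorithm runs through, and the proof consists
of bounds on their lengths. Only upper bounds matter, so completeness of the lists plays no role.

Minimal valuations. If two matrices have the same mixed differences, their difference is a function
of the row plus a function of the column. For minimal binary h × w matrices G and H, the zeros in
every row and column of G force H to arise from G by lowering a set I of rows by 1 and raising some
columns by 1 (`exists_row_col_shift`). Once G is fixed, |I| alone determines H
(`eq_of_card_lowered_eq`), so there are at most h + 1 minimal valuations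
(`length_le_of_minimalBinary`). This applies to every intermediate list as well: extension preserves
minimality, and an extended valuation determines its parent and the increase used
(`Agree.of_extend`), so the lists have no repetitions. Hence each of them has length at most 2N.

Sums. One element from each of pq lists gives at most (2N)^(pq) sums, which is polynomial because pq
is fixed.

Smooth part. All sums M are nonnegative, so A - R(M) has entries at most pq. Its minimum k is then
at most pq, which leaves at most pq + 1 decompositions, and both parts of a decomposition have (1,1)
entry at most pq (`decompose_sat`). The counts e and f stay nonnegative, so subtracting them gives
k_row, k_col ≤ pq (`recConstRows₁_sat`). The alphabet therefore has at most 2pq + 3 symbols and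
there are at most W = (2pq + 3)^(pq) windows, a number independent of N.

All remaining work costs a fixed power of N, and the product of these bounds is a constant times
(2N)^(pq) · W · N^6 (`reconstruction_time`). -/

namespace Microscope

/-! ### Cost rules for the primitives and for loops -/

section Basics
variable {α β σ : Type}

@[simp] theorem pure_val (a : α) : (pure a : Timed α).val = a := (rfl)
@[simp] theorem pure_time (a : α) : (pure a : Timed α).time = 0 := (rfl)
@[simp] theorem bind_val (x : Timed α) (f : α → Timed β) : (x >>= f).val = (f x.val).val := (rfl)
@[simp] theorem bind_time (x : Timed α) (f : α → Timed β) :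
    (x >>= f).time = x.time + (f x.val).time := (rfl)
@[simp] theorem ite_val (c : Prop) [Decidable c] (x y : Timed α) :
    (if c then x else y).val = if c then x.val else y.val := apply_ite ..
@[simp] theorem add_val [Add α] (x y : α) : (add x y).val = x + y := (rfl)
@[simp] theorem add_time [Add α] (x y : α) : (add x y).time = 1 := (rfl)
@[simp] theorem sub_val [Sub α] (x y : α) : (sub x y).val = x - y := (rfl)
@[simp] theorem sub_time [Sub α] (x y : α) : (sub x y).time = 1 := (rfl)
@[simp] theorem leq_val (x y : ℤ) : (leq x y).val = decide (x ≤ y) := (rfl)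
@[simp] theorem leq_time (x y : ℤ) : (leq x y).time = 1 := (rfl)
@[simp] theorem same_val [DecidableEq α] (x y : α) : (same x y).val = decide (x = y) := (rfl)
@[simp] theorem same_time [DecidableEq α] (x y : α) : (same x y).time = 1 := (rfl)
@[simp] theorem alloc_val (h w : ℕ) (x : α) : (alloc h w x).val = fun _ _ => x := (rfl)
@[simp] theorem alloc_time (h w : ℕ) (x : α) : (alloc h w x).time = h * w + 1 := (rfl)
@[simp] theorem copy_val (h w : ℕ) (M : Mat α) : (copy h w M).val = M := (rfl)
@[simp] theorem copy_time (h w : ℕ) (M : Mat α) : (copy h w M).time = h * w + 1 := (rfl)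
@[simp] theorem rd_val (M : Mat α) (i j : ℕ) : (rd M i j).val = M i j := (rfl)
@[simp] theorem rd_time (M : Mat α) (i j : ℕ) : (rd M i j).time = 1 := (rfl)
@[simp] theorem wr_val (M : Mat α) (i j : ℕ) (x : α) :
    (wr M i j x).val = fun r c => if r = i ∧ c = j then x else M r c := (rfl)
@[simp] theorem wr_time (M : Mat α) (i j : ℕ) (x : α) : (wr M i j x).time = 1 := (rfl)
@[simp] theorem allocV_val (l : ℕ) : (allocV l).val = fun _ => 0 := (rfl)
@[simp] theorem allocV_time (l : ℕ) : (allocV l).time = l + 1 := (rfl)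
@[simp] theorem copyV_time (l : ℕ) (v : Vec) : (copyV l v).time = l + 1 := (rfl)
@[simp] theorem rdV_val (v : Vec) (i : ℕ) : (rdV v i).val = v i := (rfl)
@[simp] theorem rdV_time (v : Vec) (i : ℕ) : (rdV v i).time = 1 := (rfl)
@[simp] theorem wrV_val (v : Vec) (i : ℕ) (x : ℤ) :
    (wrV v i x).val = fun r => if r = i then x else v r := (rfl)
@[simp] theorem wrV_time (v : Vec) (i : ℕ) (x : ℤ) : (wrV v i x).time = 1 := (rfl)
@[simp] theorem push_val (L : List α) (x : α) : (push L x).val = L ++ [x] := (rfl)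
@[simp] theorem push_time (L : List α) (x : α) : (push L x).time = 1 := (rfl)
@[simp] theorem tick_time : tick.time = 1 := (rfl)

theorem forEach_val (L : List α) (s : σ) (body : α → σ → Timed σ) :
    (forEach L s body).val = L.foldl (fun s x => (body x s).val) s := by
  induction L generalizing s with
  | nil => rfl
  | cons x xs ih => simp [forEach, ih]

/-- A loop whose body takes at most `t` steps as long as the invariant `I` holds. -/
theorem forEach_time_inv {L : List α} {s : σ} {body : α → σ → Timed σ} {t : ℕ} (I : σ → Prop)
    (h0 : I s) (hb : ∀ x ∈ L, ∀ s, I s → I (body x s).val ∧ (body x s).time ≤ t) :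
    (forEach L s body).time ≤ L.length * (t + 1) + 1 := by
  induction L generalizing s with
  | nil => simp [forEach]
  | cons x xs ih =>
    have h1 := hb x (by simp) s h0
    have h2 := ih h1.1 fun y hy s hs => hb y (by simp [hy]) s hs
    simp only [forEach, bind_time, tick_time, List.length_cons, Nat.add_mul, Nat.one_mul]
    simp only [Nat.mul_add] at h2 ⊢
    omega

theorem forEach_time {L : List α} {s : σ} {body : α → σ → Timed σ} {t : ℕ}
    (hb : ∀ x s, (body x s).time ≤ t) :
    (forEach L s body).time ≤ L.length * (t + 1) + 1 :=
  forEach_time_inv (fun _ => True) trivial fun x _ s _ => ⟨trivial, hb x s⟩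

theorem findFirst_time {L : List α} {f : α → Timed (Option β)} {t : ℕ}
    (hf : ∀ x ∈ L, (f x).time ≤ t) : (findFirst L f).time ≤ L.length * (t + 1) + 1 := by
  induction L with
  | nil => simp [findFirst]
  | cons x xs ih =>
    have h1 := hf x (by simp)
    have h2 := ih fun y hy => hf y (by simp [hy])
    simp only [findFirst, bind_time, tick_time, List.length_cons, Nat.add_mul, Nat.one_mul]
    simp only [Nat.mul_add] at h2 ⊢
    split <;> simp <;> omega

/-- The invariant is indexed by the next loop index. The hypothesis `lo ≤ hi + 1` excludes the empty
ranges for which truncated subtraction would end the loop at an index other than `hi + 1`. -/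
theorem forRange_inv {lo hi : ℕ} {s : σ} {body : ℕ → σ → Timed σ} (I : ℕ → σ → Prop)
    (hle : lo ≤ hi + 1) (h0 : I lo s)
    (hb : ∀ i s, lo ≤ i → i ≤ hi → I i s → I (i + 1) (body i s).val) :
    I (hi + 1) (forRange lo hi s body).val := by
  obtain ⟨k, hk⟩ : ∃ k, hi + 1 = lo + k := ⟨hi + 1 - lo, by omega⟩
  rw [forRange, hk, Nat.add_sub_cancel_left]
  replace hb : ∀ i s, lo ≤ i → i < lo + k → I i s → I (i + 1) (body i s).val :=
    fun i s h1 h2 => hb i s h1 (by omega)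
  clear hk hle
  induction k generalizing lo s with
  | zero => simpa [forEach] using h0
  | succ k ih =>
    simp only [List.range'_succ, forEach, bind_val]
    rw [show lo + (k + 1) = lo + 1 + k by omega]
    exact ih (hb lo s le_rfl (by omega) h0) fun i s h1 h2 => hb i s (by omega) (by omega)

/-- The cost of a pass may depend on the state, for instance on the length of a list, so the
invariant and the time bound are carried together. -/
theorem forRange_time_inv {lo hi : ℕ} {s : σ} {body : ℕ → σ → Timed σ} {t : ℕ} (I : ℕ → σ → Prop)
    (h0 : I lo s)
    (hb : ∀ i s, lo ≤ i → i ≤ hi → I i s → I (i + 1) (body i s).val ∧ (body i s).time ≤ t) :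
    (forRange lo hi s body).time ≤ (hi + 1 - lo) * (t + 1) + 1 := by
  rw [forRange]
  generalize hk : hi + 1 - lo = k
  replace hb : ∀ i s, lo ≤ i → i < lo + k → I i s →
      I (i + 1) (body i s).val ∧ (body i s).time ≤ t :=
    fun i s h1 h2 => hb i s h1 (by omega)
  clear hk
  induction k generalizing lo s with
  | zero => simp [forEach]
  | succ k ih =>
    have h1 := hb lo s le_rfl (by omega) h0
    have h2 := ih h1.1 fun i s h1 h2 => hb i s (by omega) (by omega)
    simp only [List.range'_succ, forEach, bind_time, tick_time, Nat.add_mul, Nat.one_mul]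
    simp only [Nat.mul_add] at h2 ⊢
    omega

theorem forRange_time {lo hi : ℕ} {s : σ} {body : ℕ → σ → Timed σ} {t : ℕ}
    (hb : ∀ i s, (body i s).time ≤ t) :
    (forRange lo hi s body).time ≤ (hi + 1 - lo) * (t + 1) + 1 :=
  forRange_time_inv (fun _ _ => True) trivial fun i s _ _ _ => ⟨trivial, hb i s⟩

/-- The constant grows by 2 with each level of nesting: one unit pays for the tick of each
iteration, the other for the closing tick. -/
theorem loop_le {N c k t u : ℕ} (hN : 1 ≤ N) (hu : u ≤ N) (ht : t ≤ c * N ^ k) :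
    u * (t + 1) + 1 ≤ (c + 2) * N ^ (k + 1) := by
  have h1 : 1 ≤ N ^ k := Nat.one_le_pow _ _ hN
  have h2 : 1 ≤ N ^ (k + 1) := Nat.one_le_pow _ _ hN
  calc u * (t + 1) + 1 ≤ N * (c * N ^ k + N ^ k) + N ^ (k + 1) := by gcongr
    _ = (c + 2) * N ^ (k + 1) := by ring

/-- A loop of at most `N` iterations raises the degree of a polynomial time bound by one. -/
theorem forRange_time_le {N c k lo hi : ℕ} {s : σ} {body : ℕ → σ → Timed σ} (hN : 1 ≤ N)
    (hu : hi + 1 - lo ≤ N) (hb : ∀ i s, (body i s).time ≤ c * N ^ k) :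
    (forRange lo hi s body).time ≤ (c + 2) * N ^ (k + 1) :=
  (forRange_time hb).trans (loop_le hN hu le_rfl)

theorem forRange_time_const {N c lo hi : ℕ} {s : σ} {body : ℕ → σ → Timed σ} (hN : 1 ≤ N)
    (hu : hi + 1 - lo ≤ N) (hb : ∀ i s, (body i s).time ≤ c) :
    (forRange lo hi s body).time ≤ (c + 2) * N := by
  simpa using forRange_time_le (k := 0) hN hu (by simpa using hb)

theorem forRange_time_linear {N c lo hi : ℕ} {s : σ} {body : ℕ → σ → Timed σ} (hN : 1 ≤ N)
    (hu : hi + 1 - lo ≤ N) (hb : ∀ i s, (body i s).time ≤ c * N) :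
    (forRange lo hi s body).time ≤ (c + 2) * N ^ 2 := by
  simpa using forRange_time_le (k := 1) hN hu (by simpa using hb)

end Basics

/-! ### Addresses of the lines of a subgrid -/

section Index

@[simp] theorem res_time (i p : ℕ) : (res i p).time = 3 := (rfl)
@[simp] theorem line_time (a p i : ℕ) : (line a p i).time = 3 := (rfl)
@[simp] theorem line_val (a p i : ℕ) : (line a p i).val = a + (i - 1) * p := (rfl)
@[simp] theorem lineCount_time (m a p : ℕ) : (lineCount m a p).time = 3 := (rfl)
@[simp] theorem lineCount_val (m a p : ℕ) : (lineCount m a p).val = (m - a) / p + 1 := (rfl)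

/-- Distinct lines of a subgrid have distinct addresses, so that writing into one leaves the others
intact. -/
theorem line_inj {a p i i' : ℕ} (hp : 1 ≤ p) (hi : 1 ≤ i) (hi' : 1 ≤ i') :
    a + (i - 1) * p = a + (i' - 1) * p ↔ i = i' := by
  constructor
  · intro h
    have := Nat.eq_of_mul_eq_mul_right hp (Nat.add_left_cancel h)
    omega
  · rintro rfl; rfl

theorem line_succ {b q j : ℕ} (hj : 1 ≤ j) : b + (j - 1) * q + q = b + (j + 1 - 1) * q := by
  obtain ⟨j, rfl⟩ : ∃ k, j = k + 1 := ⟨j - 1, by omega⟩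
  simp; ring

end Index

/-! ### Minimal binary matrices with prescribed mixed differences -/

section Grid

/-- `G` is a binary `h × w` matrix without a row or column of ones. -/
structure MinimalBinary (h w : ℕ) (G : ℕ → ℕ → ℤ) : Prop where
  binary : ∀ i ∈ Finset.Icc 1 h, ∀ j ∈ Finset.Icc 1 w, G i j = 0 ∨ G i j = 1
  row : ∀ i ∈ Finset.Icc 1 h, ∃ j ∈ Finset.Icc 1 w, G i j = 0
  col : ∀ j ∈ Finset.Icc 1 w, ∃ i ∈ Finset.Icc 1 h, G i j = 0

/-- The mixed differences of `G` on an `h × w` grid are given by `Y`. -/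
def HasMixedDiff (h w : ℕ) (Y : ℕ → ℕ → ℤ) (G : ℕ → ℕ → ℤ) : Prop :=
  ∀ i j, 1 ≤ i → i + 1 ≤ h → 1 ≤ j → j + 1 ≤ w →
    G i j + G (i + 1) (j + 1) - G (i + 1) j - G i (j + 1) = Y i j

/-- The mixed differences of G - H vanish, so its vertical differences are the same in every column;
summing them down from the first row gives the formula. -/
theorem mixed_diff_unique {h w : ℕ} {Y G H : ℕ → ℕ → ℤ} (hG : HasMixedDiff h w Y G)
    (hH : HasMixedDiff h w Y H) {i j : ℕ} (hi : i ∈ Finset.Icc 1 h) (hj : j ∈ Finset.Icc 1 w) :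
    G i j - H i j = (G i 1 - H i 1) + (G 1 j - H 1 j) - (G 1 1 - H 1 1) := by
  have row : ∀ i, 1 ≤ i → i + 1 ≤ h → ∀ j, 1 ≤ j → j ≤ w →
      (G (i + 1) j - H (i + 1) j) - (G i j - H i j) =
        (G (i + 1) 1 - H (i + 1) 1) - (G i 1 - H i 1) := by
    intro i hi hi' j hj
    induction j, hj using Nat.le_induction with
    | base => intro; rfl
    | succ j hj ih =>
      intro hj'
      have := ih (by omega)
      have h1 := hG i j hi hi' hj hj'
      have h2 := hH i j hi hi' hj hj'
      linarith
  rw [Finset.mem_Icc] at hi hj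
  obtain ⟨hi, hi'⟩ := hi
  induction i, hi using Nat.le_induction with
  | base => ring
  | succ i hi ih =>
    have := ih (by omega)
    have := row i hi hi' j hj.1 hj.2
    linarith

/-- Two minimal binary matrices with the same mixed differences differ by lowering some rows
and raising some columns by one. -/
theorem exists_row_col_shift {h w : ℕ} {Y G H : ℕ → ℕ → ℤ} (hh : 1 ≤ h) (hw : 1 ≤ w)
    (mG : MinimalBinary h w G) (mH : MinimalBinary h w H)
    (hG : HasMixedDiff h w Y G) (hH : HasMixedDiff h w Y H) :
    ∃ (I : Finset ℕ) (β : ℕ → ℤ), I ⊆ Finset.Icc 1 h ∧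
      (∀ j ∈ Finset.Icc 1 w, β j = 0 ∨ β j = 1) ∧
      ∀ i ∈ Finset.Icc 1 h, ∀ j ∈ Finset.Icc 1 w,
        H i j = G i j - (if i ∈ I then 1 else 0) + β j := by
  -- Row r is the reference row: by maximality, every other row is raised at most as much as r when
  -- passing from G to H.
  obtain ⟨r, hr, hmax⟩ := Finset.exists_max_image (Finset.Icc 1 h) (fun i => H i 1 - G i 1)
    ⟨1, by simp [hh]⟩
  have key : ∀ i ∈ Finset.Icc 1 h, ∀ j ∈ Finset.Icc 1 w,
      H i j - G i j = (H i 1 - G i 1) - (H r 1 - G r 1) + (H r j - G r j) := by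
    intro i hi j hj
    have h1 := mixed_diff_unique hH hG hi hj
    have h2 := mixed_diff_unique hH hG hr hj
    linarith
  have one : (1 : ℕ) ∈ Finset.Icc 1 w := by simp [hw]
  -- Where column j of G has a zero, H - G is nonnegative, and row r dominates that row; hence the
  -- difference in row r is not -1.
  have hβ : ∀ j ∈ Finset.Icc 1 w, H r j - G r j = 0 ∨ H r j - G r j = 1 := by
    intro j hj
    obtain ⟨i, hi, h0⟩ := mG.col j hj
    have h1 := key i hi j hj
    have h2 := hmax i hi
    have h3 := mH.binary i hi j hj
    have h4 := mH.binary r hr j hj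
    have h5 := mG.binary r hr j hj
    omega
  refine ⟨(Finset.Icc 1 h).filter fun i => H i 1 - G i 1 ≠ H r 1 - G r 1,
    fun j => H r j - G r j, Finset.filter_subset _ _, hβ, fun i hi j hj => ?_⟩
  -- At a zero of G in row i, H - G is nonnegative while row r is raised by at most 1 there. So row
  -- i falls behind row r by 0 or 1.
  obtain ⟨c, hc, h0⟩ := mG.row i hi
  have h1 := key i hi j hj
  have h2 := key i hi c hc
  have h3 := hβ c hc
  have h4 := hmax i hi
  have h5 := mH.binary i hi c hc
  simp only [Finset.mem_filter, hi, true_and]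
  split_ifs <;> omega

/-- Given a base `G`, a minimal binary matrix with the same mixed differences is
determined by the number of lowered rows. -/
theorem eq_of_card_lowered_eq {h w : ℕ} {G H K : ℕ → ℕ → ℤ} (mG : MinimalBinary h w G)
    (mH : MinimalBinary h w H) (mK : MinimalBinary h w K) {I J : Finset ℕ} {β γ : ℕ → ℤ}
    (hI : I ⊆ Finset.Icc 1 h) (hJ : J ⊆ Finset.Icc 1 h)
    (hβ : ∀ j ∈ Finset.Icc 1 w, β j = 0 ∨ β j = 1)
    (hγ : ∀ j ∈ Finset.Icc 1 w, γ j = 0 ∨ γ j = 1)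
    (hH : ∀ i ∈ Finset.Icc 1 h, ∀ j ∈ Finset.Icc 1 w,
      H i j = G i j - (if i ∈ I then 1 else 0) + β j)
    (hK : ∀ i ∈ Finset.Icc 1 h, ∀ j ∈ Finset.Icc 1 w,
      K i j = G i j - (if i ∈ J then 1 else 0) + γ j)
    (hcard : I.card = J.card) :
    ∀ i ∈ Finset.Icc 1 h, ∀ j ∈ Finset.Icc 1 w, H i j = K i j := by
  by_cases hIJ : I = J
  -- Now H - K is constant along each column. It is ≤ 0 at a zero of H and ≥ 0 at a zero of K.
  · subst hIJ
    intro i hi j hj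
    obtain ⟨r, hr, h0⟩ := mH.col j hj
    obtain ⟨s, hs, h0'⟩ := mK.col j hj
    have := hH i hi j hj
    have := hK i hi j hj
    have := hH r hr j hj
    have := hK r hr j hj
    have := hH s hs j hj
    have := hK s hs j hj
    have := mH.binary s hs j hj
    have := mK.binary r hr j hj
    omega
  · exfalso
    have h1 : ¬ I ⊆ J := fun hs => hIJ (Finset.eq_of_subset_of_card_le hs hcard.ge)
    have h2 : ¬ J ⊆ I := fun hs => hIJ (Finset.eq_of_subset_of_card_le hs hcard.le).symm
    obtain ⟨r, hrI, hrJ⟩ := Finset.not_subset.1 h1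
    obtain ⟨s, hsJ, hsI⟩ := Finset.not_subset.1 h2
    have hr := hI hrI
    have hs := hJ hsJ
    -- Row r is lowered only in H and row s only in K. A zero of K in row r gives G r j = 0 and γ j
    -- = 0. Then H r j ≥ 0 forces β j = 1, and K s j ≥ 0 forces G s j = 1, so H s j = 2.
    obtain ⟨j, hj, h0⟩ := mK.row r hr
    have e1 := hH r hr j hj
    have e2 := hK r hr j hj
    have e3 := hH s hs j hj
    have e4 := hK s hs j hj
    simp only [hrI, hrJ, hsI, hsJ, if_true, if_false] at e1 e2 e3 e4
    have := mG.binary r hr j hj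
    have := mG.binary s hs j hj
    have := mH.binary r hr j hj
    have := mH.binary s hs j hj
    have := mK.binary s hs j hj
    have := hβ j hj
    have := hγ j hj
    omega

/-- At most `h + 1` minimal binary `h × w` matrices have given mixed differences. -/
theorem length_le_of_minimalBinary {h w : ℕ} {Y : ℕ → ℕ → ℤ} (hh : 1 ≤ h) (hw : 1 ≤ w)
    (L : List (ℕ → ℕ → ℤ)) (hmin : ∀ G ∈ L, MinimalBinary h w G)
    (hY : ∀ G ∈ L, HasMixedDiff h w Y G)
    (hL : L.Pairwise fun G H => ¬ ∀ i ∈ Finset.Icc 1 h, ∀ j ∈ Finset.Icc 1 w, G i j = H i j) :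
    L.length ≤ h + 1 := by
  cases hL0 : L with
  | nil => simp
  | cons G L' =>
    rw [← hL0]
    have hG : G ∈ L := by simp [hL0]
    -- The shift is chosen for all matrices at once, with a dummy value off `L`, so that `choose`
    -- yields total functions.
    have ex : ∀ H, ∃ (I : Finset ℕ) (β : ℕ → ℤ), H ∈ L → (I ⊆ Finset.Icc 1 h ∧
        (∀ j ∈ Finset.Icc 1 w, β j = 0 ∨ β j = 1) ∧
        ∀ i ∈ Finset.Icc 1 h, ∀ j ∈ Finset.Icc 1 w,
          H i j = G i j - (if i ∈ I then 1 else 0) + β j) := by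
      intro H
      by_cases hH : H ∈ L
      · obtain ⟨I, β, hI⟩ :=
          exists_row_col_shift hh hw (hmin G hG) (hmin H hH) (hY G hG) (hY H hH)
        exact ⟨I, β, fun _ => hI⟩
      · exact ⟨∅, 0, fun h => absurd h hH⟩
    choose I β hI using ex
    -- The numbers of lowered rows are pairwise distinct and lie in {0, …, h}, whence the bound h +
    -- 1.
    have nd : (L.map fun H => (I H).card).Nodup := by
      rw [List.Nodup, List.pairwise_map]
      refine hL.imp_of_mem fun {H K} hH hK hne hcard => hne ?_
      obtain ⟨a1, a2, a3⟩ := hI H hH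
      obtain ⟨b1, b2, b3⟩ := hI K hK
      exact eq_of_card_lowered_eq (hmin G hG) (hmin H hH) (hmin K hK) a1 b1 a2 b2 a3 b3 hcard
    have sub : (L.map fun H => (I H).card).toFinset ⊆ Finset.range (h + 1) := by
      intro k hk
      simp only [List.mem_toFinset, List.mem_map] at hk
      obtain ⟨H, hH, rfl⟩ := hk
      have := Finset.card_le_card (hI H hH).1
      simp at this ⊢
      omega
    have := Finset.card_le_card sub
    rw [List.toFinset_card_of_nodup nd] at this
    simpa using this

end Grid

/-! ### What one extension step does to a valuation -/

theorem isZeroRow_val {b q j r : ℕ} {V : Mat ℤ} (h : (isZeroRow b q j r V).val = true) :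
    ∀ c ∈ Finset.Icc 1 j, V r (b + (c - 1) * q) = 0 := by
  have := forRange_inv (lo := 1) (hi := j) (s := true)
    (body := fun c ok => do
      if (← same (← rd V r (← line b q c)) 0) then pure ok else pure false)
    (fun k ok => ok = true → ∀ c ∈ Finset.Ico 1 k, V r (b + (c - 1) * q) = 0)
    (by omega) (by simp) (by
      intro i ok h1 h2 ih
      simp only [bind_val, rd_val, line_val, same_val, ite_val, pure_val]
      split_ifs with hc
      · intro hok c hc'
        rw [Finset.mem_Ico] at hc'
        rcases eq_or_lt_of_le (Nat.lt_succ_iff.1 hc'.2) with rfl | hlt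
        · simpa using hc
        · exact ih hok c (by simp; omega)
      · simp)
  intro c hc
  exact this h c (by simpa [Nat.lt_succ_iff] using hc)

theorem hasFullColumn_val {a b p q h j : ℕ} {V : Mat ℤ}
    (hf : (hasFullColumn a b p q h j V).val = false) :
    ∀ c ∈ Finset.Icc 1 j, ∃ i ∈ Finset.Icc 1 h, V (a + (i - 1) * p) (b + (c - 1) * q) ≠ 1 := by
  have inner : ∀ y, (forRange 1 h true fun i ok => do
      if (← same (← rd V (← line a p i) y) 1) then pure ok else pure false).val = false →
      ∃ i ∈ Finset.Icc 1 h, V (a + (i - 1) * p) y ≠ 1 := by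
    intro y
    have := forRange_inv (lo := 1) (hi := h) (s := true)
      (body := fun i ok => do
        if (← same (← rd V (← line a p i) y) 1) then pure ok else pure false)
      (fun k ok => k ≤ h + 1 ∧ (ok = false → ∃ i ∈ Finset.Icc 1 h, V (a + (i - 1) * p) y ≠ 1))
      (by omega) (by simp) (by
        intro i ok h1 h2 ih
        refine ⟨by omega, ?_⟩
        simp only [bind_val, rd_val, line_val, same_val, ite_val, pure_val]
        split_ifs with hc
        · exact ih.2
        · intro _
          exact ⟨i, by simp; omega, by simpa using hc⟩)
    exact this.2
  have := forRange_inv (lo := 1) (hi := j) (s := false)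
    (body := fun c found => do
      let y ← line b q c
      let full ← forRange 1 h true fun i ok => do
        if (← same (← rd V (← line a p i) y) 1) then pure ok else pure false
      if full then pure true else pure found)
    (fun k found => found = false → ∀ c ∈ Finset.Ico 1 k, ∃ i ∈ Finset.Icc 1 h,
      V (a + (i - 1) * p) (b + (c - 1) * q) ≠ 1)
    (by omega) (by simp) (by
      intro i found h1 h2 ih
      rw [bind_val, bind_val, ite_val]
      simp only [line_val, pure_val]
      split_ifs with hc
      · simp
      · intro hok c hc'
        rw [Finset.mem_Ico] at hc'
        rcases eq_or_lt_of_le (Nat.lt_succ_iff.1 hc'.2) with rfl | hlt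
        · exact inner _ (by simpa using hc)
        · exact ih hok c (by simp; omega))
  intro c hc
  exact this hf c (by simpa [Nat.lt_succ_iff] using hc)

/-- The matrix of the values of `V` on the `(a, b)`-subgrid. -/
def subgrid (a b p q : ℕ) (V : Mat ℤ) : ℕ → ℕ → ℤ :=
  fun i j => V (a + (i - 1) * p) (b + (j - 1) * q)

/-- The increase from column `j` to column `j + 1` in row `i` of an extension whose first
entry increases by `c`. -/
def increase (a b p q j : ℕ) (X : Mat ℤ) (c : ℤ) (i : ℕ) : ℤ :=
  c + ∑ k ∈ Finset.Ico 1 i, subgrid a b p q X k j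

/-- Row `i` of `G'` extends row `i` of `G` to column `j + 1`. -/
def RowExtends (j : ℕ) (G G' : ℕ → ℕ → ℤ) (i : ℕ) : Prop :=
  ((∀ c ∈ Finset.Icc 1 j, G' i c = G i c) ∧ (G' i (j + 1) = 0 ∨ G' i (j + 1) = 1)) ∨
    ((∀ c ∈ Finset.Icc 1 j, G i c = 0 ∧ G' i c = 1) ∧ G' i (j + 1) = 0)

/-- The running value d is the jump from column j to column j + 1 that the mixed differences
prescribe in the current row: c plus the entries of X above it. Each successful branch of the body
realises exactly this jump. The loop is spelled out with the addresses already evaluated so that it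
matches the unfolded `extend`. -/
theorem extend_row_loop {a b p q h j : ℕ} (hp : 1 ≤ p) (hq : 1 ≤ q) (hj : 1 ≤ j) (X : Mat ℤ)
    (c : ℤ) (V : Mat ℤ) (hV : ∀ r c, 0 ≤ V r c) {V' : Mat ℤ} {d : ℤ}
    (hV' : (forRange 1 h (some V, c) fun i (st : Option (Mat ℤ) × ℤ) =>
    match st with
    | (none, d) => pure (none, d)
    | (some V, d) => do
      let x ← line a p i
      let v ← add (← rd V x (b + (j - 1) * q)) d
      let d' ← if (← same i h) then pure d else add d (← rd X x (b + (j - 1) * q))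
      if (← same v 0) then
        pure (some (← wr V x (b + (j - 1) * q + q) 0), d')
      else if (← same v 1) then
        pure (some (← wr V x (b + (j - 1) * q + q) 1), d')
      else if (← same v (-1)) then
        if (← isZeroRow b q j x V) then
          let V ← forRange 1 j V fun c V => do wr V x (← line b q c) 1
          pure (some (← wr V x (b + (j - 1) * q + q) 0), d')
        else pure (none, d')
      else pure (none, d')).val = (some V', d)) :
    (∀ r c, 0 ≤ V' r c) ∧ ∀ i ∈ Finset.Icc 1 h,
      RowExtends j (subgrid a b p q V) (subgrid a b p q V') i ∧
      subgrid a b p q V' i (j + 1) - subgrid a b p q V' i j = increase a b p q j X c i := by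
  have key := forRange_inv (lo := 1) (hi := h) (s := (some V, c))
    (body := fun i (st : Option (Mat ℤ) × ℤ) =>
    match st with
    | (none, d) => pure (none, d)
    | (some V, d) => do
      let x ← line a p i
      let v ← add (← rd V x (b + (j - 1) * q)) d
      let d' ← if (← same i h) then pure d else add d (← rd X x (b + (j - 1) * q))
      if (← same v 0) then
        pure (some (← wr V x (b + (j - 1) * q + q) 0), d')
      else if (← same v 1) then
        pure (some (← wr V x (b + (j - 1) * q + q) 1), d')
      else if (← same v (-1)) then
        if (← isZeroRow b q j x V) then
          let V ← forRange 1 j V fun c V => do wr V x (← line b q c) 1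
          pure (some (← wr V x (b + (j - 1) * q + q) 0), d')
        else pure (none, d')
      else pure (none, d'))
    -- Rows before i are finished and all others are still those of V; a failed state satisfies this
    -- vacuously. The value d is controlled only for i ≤ h, because it is not updated in the last
    -- row.
    (fun i st => ∀ V1, st.1 = some V1 → (∀ r c, 0 ≤ V1 r c) ∧
      (∀ r c, (∀ i', 1 ≤ i' → i' < i → r ≠ a + (i' - 1) * p) → V1 r c = V r c) ∧
      (i ≤ h → st.2 = increase a b p q j X c i) ∧
      ∀ i', 1 ≤ i' → i' < i →
        RowExtends j (subgrid a b p q V) (subgrid a b p q V1) i' ∧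
        subgrid a b p q V1 i' (j + 1) - subgrid a b p q V1 i' j = increase a b p q j X c i')
    (by omega) (by
      rintro V1 hV1
      obtain rfl : V = V1 := by simpa using hV1
      refine ⟨hV, fun _ _ _ => rfl, fun _ => by simp [increase], fun i' h1 h2 => by omega⟩) ?_
  · have := key V' (by rw [hV'])
    refine ⟨this.1, fun i hi => ?_⟩
    rw [Finset.mem_Icc] at hi
    exact this.2.2.2 i hi.1 (by omega)
  · rintro i ⟨_ | V1, d⟩ hi1 hi2 ih
    · simp
    obtain ⟨hnn, hout, hd, hrows⟩ := ih V1 rfl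
    replace hd : d = _ := hd hi2
    have hcur : ∀ c, V1 (a + (i - 1) * p) c = V (a + (i - 1) * p) c := fun c =>
      hout _ c fun i' h1 h2 h3 => by
        have := (line_inj hp hi1 h1).1 h3
        omega
    have hinc : i + 1 ≤ h → increase a b p q j X c (i + 1) =
        increase a b p q j X c i + X (a + (i - 1) * p) (b + (j - 1) * q) := by
      intro _
      rw [increase, increase, Finset.sum_Ico_succ_top hi1, subgrid]; ring
    -- the effect of replacing row `i`
    have step : ∀ (V2 : Mat ℤ) (d' : ℤ), (∀ r c, r ≠ a + (i - 1) * p → V2 r c = V1 r c) →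
        (∀ c, 0 ≤ V2 (a + (i - 1) * p) c) →
        RowExtends j (subgrid a b p q V) (subgrid a b p q V2) i →
        subgrid a b p q V2 i (j + 1) - subgrid a b p q V2 i j = increase a b p q j X c i →
        (i + 1 ≤ h → d' = increase a b p q j X c (i + 1)) →
        ∀ V3, some V2 = some V3 → (∀ r c, 0 ≤ V3 r c) ∧
      (∀ r c, (∀ i', 1 ≤ i' → i' < i + 1 → r ≠ a + (i' - 1) * p) → V3 r c = V r c) ∧
      (i + 1 ≤ h → d' = increase a b p q j X c (i + 1)) ∧
      ∀ i', 1 ≤ i' → i' < i + 1 →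
        RowExtends j (subgrid a b p q V) (subgrid a b p q V3) i' ∧
        subgrid a b p q V3 i' (j + 1) - subgrid a b p q V3 i' j =
          increase a b p q j X c i' := by
      rintro V2 d' s1 s2 s3 s4 s5 V3 hV3
      obtain rfl : V2 = V3 := by simpa using hV3
      refine ⟨fun r c => ?_, fun r c hr => ?_, s5, fun i' h1 h2 => ?_⟩
      · by_cases hr : r = a + (i - 1) * p
        · rw [hr]; exact s2 c
        · rw [s1 r c hr]; exact hnn r c
      · rw [s1 r c (hr i hi1 (by omega))]
        exact hout r c fun i' h1 h2 => hr i' h1 (by omega)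
      · rcases eq_or_lt_of_le (Nat.lt_succ_iff.1 h2) with rfl | hlt
        · exact ⟨s3, s4⟩
        · have e : ∀ c, subgrid a b p q V2 i' c = subgrid a b p q V1 i' c := fun c =>
            s1 _ _ fun h3 => by
              have := (line_inj hp h1 hi1).1 h3
              omega
          have := hrows i' h1 hlt
          simp only [RowExtends, e] at this ⊢
          exact this
    have last : i = h → i + 1 ≤ h → d = increase a b p q j X c (i + 1) := by omega
    have next : i + 1 ≤ h → d + X (a + (i - 1) * p) (b + (j - 1) * q) =
        increase a b p q j X c (i + 1) := fun hih => by rw [hinc hih, hd]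
    have hcol : ∀ c ∈ Finset.Icc 1 j, b + (c - 1) * q ≠ b + (j - 1) * q + q := by
      intro c hc h3
      rw [Finset.mem_Icc] at hc
      rw [line_succ hj] at h3
      have := (line_inj hq hc.1 (by omega)).1 h3
      omega
    have hjj : j ∈ Finset.Icc 1 j := by simp [hj]
    -- The two ordinary branches, where the row is kept and the new entry v is 0 or 1.
    have bit : ∀ (v d' : ℤ), (i + 1 ≤ h → d' = increase a b p q j X c (i + 1)) →
        (v = 0 ∨ v = 1) → V1 (a + (i - 1) * p) (b + (j - 1) * q) + d = v →
        ∀ V3, some (fun r c => if r = a + (i - 1) * p ∧ c = b + (j - 1) * q + q then v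
          else V1 r c) = some V3 → (∀ r c, 0 ≤ V3 r c) ∧
      (∀ r c, (∀ i', 1 ≤ i' → i' < i + 1 → r ≠ a + (i' - 1) * p) → V3 r c = V r c) ∧
      (i + 1 ≤ h → d' = increase a b p q j X c (i + 1)) ∧
      ∀ i', 1 ≤ i' → i' < i + 1 →
        RowExtends j (subgrid a b p q V) (subgrid a b p q V3) i' ∧
        subgrid a b p q V3 i' (j + 1) - subgrid a b p q V3 i' j =
          increase a b p q j X c i' := by
      intro v d' hd' hv hvd
      refine step _ d' (fun r c hr => by simp [hr]) (fun c => ?_) (Or.inl ⟨?_, ?_⟩) ?_ hd'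
      · split_ifs
        · omega
        · exact hnn _ _
      · intro c hc
        simp [subgrid, hcol c hc, hcur]
      · simp only [subgrid, ← line_succ hj, and_self, if_true]
        exact hv
      · simp only [subgrid, ← line_succ hj, hcol j hjj, true_and, if_true, if_false]
        rw [← hd, ← hvd]; ring
    -- Whether d is updated depends on i = h. In the last row the claim about the next d is vacuous
    -- (`last`), otherwise it is `next`.
    obtain hih | hih : (i = h) = True ∨ (i = h) = False := by by_cases hih : i = h <;> simp [hih]
    all_goals
      simp only [bind_val, line_val, rd_val, same_val, add_val, ite_val,
        hih, if_true, if_false, pure_val, wr_val, decide_eq_true_eq, apply_ite Prod.fst]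
      split_ifs with c0 c1 c2 c3
      · exact bit 0 _ (by first | exact next | exact last (of_eq_true hih)) (by simp) c0
      · exact bit 1 _ (by first | exact next | exact last (of_eq_true hih)) (by simp) c1
      -- The refilling branch: the old entry is 0 and the sum is -1, so d = -1. Replacing the zeros
      -- by ones followed by a 0 realises this jump without leaving {0, 1}.
      · have hz := isZeroRow_val c3
        have hfill := forRange_inv (lo := 1) (hi := j) (s := V1)
          (body := fun c V => do wr V (a + (i - 1) * p) (← line b q c) 1)
          (fun k W => (∀ r c, r ≠ a + (i - 1) * p → W r c = V1 r c) ∧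
            (∀ c, 0 ≤ W (a + (i - 1) * p) c) ∧
            ∀ c, 1 ≤ c → c < k → W (a + (i - 1) * p) (b + (c - 1) * q) = 1)
          (by omega) ⟨fun _ _ _ => rfl, fun _ => hnn _ _, fun c h1 h2 => by omega⟩ (by
            rintro k W hk1 hk2 ⟨w1, w2, w3⟩
            simp only [bind_val, line_val, wr_val]
            refine ⟨fun r c hr => by simp [hr, w1 r c hr], fun c => ?_, fun c h1 h2 => ?_⟩
            · split_ifs
              · omega
              · exact w2 c
            · simp only [true_and]
              split_ifs with hc
              · rfl
              · rcases eq_or_lt_of_le (Nat.lt_succ_iff.1 h2) with rfl | hlt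
                · exact absurd rfl hc
                · exact w3 c h1 hlt)
        obtain ⟨w1, w2, w3⟩ := hfill
        dsimp only
        refine step _ _ (fun r c hr => by simpa [hr] using w1 r c hr) (fun c => ?_)
          (Or.inr ⟨?_, ?_⟩) ?_ (by first | exact next | exact last (of_eq_true hih))
        · split_ifs
          · omega
          · exact w2 c
        · intro c hc
          refine ⟨?_, ?_⟩
          · rw [subgrid, ← hcur]; exact hz c hc
          · simp only [subgrid, hcol c hc, and_false, if_false]
            rw [Finset.mem_Icc] at hc
            exact w3 c hc.1 (by omega)
        · simp only [subgrid, ← line_succ hj, and_self, if_true]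
        · simp only [subgrid, ← line_succ hj, hcol j hjj, true_and, if_true, if_false]
          rw [← hd]
          have := w3 j hj (by omega)
          have := hz j hjj
          omega
      · simp
      · simp

/-! ### Minimality and uniqueness of the parent under extension -/

section Extensions
variable {h j : ℕ} {Y G H G' H' : ℕ → ℕ → ℤ}

/-- A row is either kept or raised uniformly from 0 to 1, so horizontal differences, and with them
the earlier mixed differences, survive. -/
theorem RowExtends.sub_eq {i : ℕ} (hi : RowExtends j G G' i) {c : ℕ} (hc : 1 ≤ c)
    (hc' : c + 1 ≤ j) : G' i (c + 1) - G' i c = G i (c + 1) - G i c := by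
  have h1 : c ∈ Finset.Icc 1 j := by simp; omega
  have h2 : c + 1 ∈ Finset.Icc 1 j := by simp; omega
  rcases hi with ⟨e, -⟩ | ⟨e, -⟩
  · rw [e c h1, e (c + 1) h2]
  · rw [(e c h1).1, (e _ h2).1, (e c h1).2, (e _ h2).2]; rfl

/-- A kept row retains its zero and a refilled row ends in 0. Full columns are excluded by the
explicit test. -/
theorem MinimalBinary.extend (mG : MinimalBinary h j G)
    (hrow : ∀ i ∈ Finset.Icc 1 h, RowExtends j G G' i)
    (hcol : ∀ c ∈ Finset.Icc 1 (j + 1), ∃ i ∈ Finset.Icc 1 h, G' i c ≠ 1) :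
    MinimalBinary h (j + 1) G' := by
  have hb : ∀ i ∈ Finset.Icc 1 h, ∀ c ∈ Finset.Icc 1 (j + 1), G' i c = 0 ∨ G' i c = 1 := by
    intro i hi c hc
    rcases eq_or_ne c (j + 1) with rfl | hne
    · rcases hrow i hi with ⟨-, e⟩ | ⟨-, e⟩
      · exact e
      · exact Or.inl e
    · have hc' : c ∈ Finset.Icc 1 j := by simp at hc ⊢; omega
      rcases hrow i hi with ⟨e, -⟩ | ⟨e, -⟩
      · rw [e c hc']; exact mG.binary i hi c hc'
      · exact Or.inr (e c hc').2
  refine ⟨hb, fun i hi => ?_, fun c hc => ?_⟩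
  · rcases hrow i hi with ⟨e, -⟩ | ⟨-, e⟩
    · obtain ⟨c, hc, h0⟩ := mG.row i hi
      exact ⟨c, Finset.Icc_subset_Icc_right (by omega) hc, by rw [e c hc, h0]⟩
    · exact ⟨j + 1, by simp, e⟩
  · obtain ⟨i, hi, h1⟩ := hcol c hc
    exact ⟨i, hi, (hb i hi c hc).resolve_right h1⟩

/-- The extended row reveals what was done to it: a refilled row is all ones on the first j columns,
whereas a kept row still has the zero required by minimality. -/
theorem eq_of_rowExtends (mG : MinimalBinary h j G) (mH : MinimalBinary h j H)
    (hG : ∀ i ∈ Finset.Icc 1 h, RowExtends j G G' i)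
    (hH : ∀ i ∈ Finset.Icc 1 h, RowExtends j H H' i)
    (he : ∀ i ∈ Finset.Icc 1 h, ∀ c ∈ Finset.Icc 1 (j + 1), G' i c = H' i c) :
    ∀ i ∈ Finset.Icc 1 h, ∀ c ∈ Finset.Icc 1 j, G i c = H i c := by
  intro i hi c hc
  have he' := fun c hc => he i hi c (Finset.Icc_subset_Icc_right (Nat.le_succ j) hc)
  rcases hG i hi with ⟨e, -⟩ | ⟨e, -⟩ <;> rcases hH i hi with ⟨f, -⟩ | ⟨f, -⟩
  · rw [← e c hc, ← f c hc, he' c hc]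
  · obtain ⟨d, hd, h0⟩ := mG.row i hi
    have := e d hd
    have := (f d hd).2
    have := he' d hd
    omega
  · obtain ⟨d, hd, h0⟩ := mH.row i hi
    have := f d hd
    have := (e d hd).2
    have := he' d hd
    omega
  · rw [(e c hc).1, (f c hc).1]

end Extensions

/-- `V` is nonnegative and is, on the first `j` columns of the `(a, b)`-subgrid,
a minimal valuation for `X`. -/
structure MinimalValuation (a b p q h j : ℕ) (X V : Mat ℤ) : Prop where
  nonneg : ∀ r c, 0 ≤ V r c
  minimal : MinimalBinary h j (subgrid a b p q V)
  mixedDiff : HasMixedDiff h j (subgrid a b p q X) (subgrid a b p q V)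

/-- `V` and `V'` agree on the first `j` columns of the `(a, b)`-subgrid. -/
def Agree (a b p q h j : ℕ) (V V' : Mat ℤ) : Prop :=
  ∀ i ∈ Finset.Icc 1 h, ∀ c ∈ Finset.Icc 1 j, subgrid a b p q V i c = subgrid a b p q V' i c

/-! ### The lists of minimal valuations are short -/

section Listing
variable {m n a b p q h j : ℕ} {X V W V' W' : Mat ℤ} {c d : ℤ}

theorem extend_val (hp : 1 ≤ p) (hq : 1 ≤ q) (hj : 1 ≤ j) (hV : ∀ r c, 0 ≤ V r c)
    (hV' : (extend m n p q a b h j X c V).val = some V') :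
    (∀ r c, 0 ≤ V' r c) ∧
    (∀ i ∈ Finset.Icc 1 h, RowExtends j (subgrid a b p q V) (subgrid a b p q V') i ∧
      subgrid a b p q V' i (j + 1) - subgrid a b p q V' i j = increase a b p q j X c i) ∧
    ∀ c ∈ Finset.Icc 1 (j + 1), ∃ i ∈ Finset.Icc 1 h, subgrid a b p q V' i c ≠ 1 := by
  rw [extend, bind_val, bind_val, bind_val, bind_val] at hV'
  simp only [copy_val, line_val, add_val] at hV'
  generalize hout : Timed.val (forRange 1 h (some V, c) _) = out at hV'
  rcases out with ⟨_ | V1, d⟩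
  · simp at hV'
  · simp only [bind_val, add_val, ite_val, pure_val] at hV'
    split_ifs at hV' with hf
    obtain rfl : V1 = V' := by simpa using hV'
    obtain ⟨h1, h2⟩ := extend_row_loop hp hq hj X c V hV hout
    exact ⟨h1, h2, hasFullColumn_val (by simpa using hf)⟩

theorem MinimalValuation.extend (hp : 1 ≤ p) (hq : 1 ≤ q) (hj : 1 ≤ j)
    (mV : MinimalValuation a b p q h j X V)
    (hV' : (extend m n p q a b h j X c V).val = some V') :
    MinimalValuation a b p q h (j + 1) X V' := by
  obtain ⟨h1, h2, h3⟩ := extend_val hp hq hj mV.nonneg hV'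
  refine ⟨h1, mV.minimal.extend (fun i hi => (h2 i hi).1) h3, ?_⟩
  intro i k hi hi' hk hk'
  have m1 := h2 i (by simp; omega)
  have m2 := h2 (i + 1) (by simp; omega)
  -- Between columns j and j + 1 the prescribed jumps of consecutive rows differ by the entry of X;
  -- further left the old mixed differences are unchanged.
  rcases eq_or_ne k j with rfl | hne
  · have e : increase a b p q k X c (i + 1) = increase a b p q k X c i + subgrid a b p q X i k := by
      rw [increase, increase, Finset.sum_Ico_succ_top hi]; ring
    have := m1.2
    have := m2.2
    linarith
  · have e1 := m1.1.sub_eq hk (by omega)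
    have e2 := m2.1.sub_eq hk (by omega)
    have := mV.mixedDiff i k hi hi' hk (by omega)
    linarith

/-- No valuation is produced twice: the parent is recovered from the rows, and c is the jump in the
first row. -/
theorem Agree.of_extend (hp : 1 ≤ p) (hq : 1 ≤ q) (hj : 1 ≤ j) (hh : 1 ≤ h)
    (mV : MinimalValuation a b p q h j X V) (mW : MinimalValuation a b p q h j X W)
    (hV' : (extend m n p q a b h j X c V).val = some V')
    (hW' : (extend m n p q a b h j X d W).val = some W')
    (he : Agree a b p q h (j + 1) V' W') : Agree a b p q h j V W ∧ c = d := by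
  obtain ⟨-, v, -⟩ := extend_val hp hq hj mV.nonneg hV'
  obtain ⟨-, w, -⟩ := extend_val hp hq hj mW.nonneg hW'
  refine ⟨eq_of_rowExtends mV.minimal mW.minimal (fun i hi => (v i hi).1)
    (fun i hi => (w i hi).1) he, ?_⟩
  have h1 : 1 ∈ Finset.Icc 1 h := by simp [hh]
  have := (v 1 h1).2
  have := (w 1 h1).2
  have := he 1 h1 j (by simp [hj])
  have := he 1 h1 (j + 1) (by simp)
  simp only [increase, Finset.Ico_self, Finset.sum_empty] at *
  linarith

/-- Turns accumulating loops into `flatMap`, for which lengths and pairwise relations are easy to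
compute. -/
theorem forEach_append_val {α β : Type} {L : List α} {s : List β}
    {body : α → List β → Timed (List β)} (f : α → List β)
    (hb : ∀ x s, (body x s).val = s ++ f x) : (forEach L s body).val = s ++ L.flatMap f := by
  rw [forEach_val]
  induction L generalizing s with
  | nil => simp
  | cons x xs ih => rw [List.foldl_cons, hb, ih, List.append_assoc, List.flatMap_cons]

theorem extendAll_val (L : List (Mat ℤ)) :
    (forEach L [] fun V L' => forEach [-1, 0, 1] L' fun c L' => do
      match (← extend m n p q a b h j X c V) with
      | none => pure L'
      | some V' => push L' V').val =
    L.flatMap fun V => [-1, 0, 1].flatMap fun c => (extend m n p q a b h j X c V).val.toList := by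
  rw [forEach_append_val fun V => [-1, 0, 1].flatMap fun c =>
    (extend m n p q a b h j X c V).val.toList, List.nil_append]
  intro V s
  apply forEach_append_val
  intro c s
  rw [bind_val]
  cases (extend m n p q a b h j X c V).val <;> simp

/-- The sequence `L` lists distinct minimal valuations of the first `j` columns. -/
def Listing (a b p q h j : ℕ) (X : Mat ℤ) (L : List (Mat ℤ)) : Prop :=
  (∀ V ∈ L, MinimalValuation a b p q h j X V) ∧ L.Pairwise fun V W => ¬ Agree a b p q h j V W

theorem Listing.length_le {L : List (Mat ℤ)} (hh : 1 ≤ h) (hj : 1 ≤ j)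
    (hL : Listing a b p q h j X L) : L.length ≤ h + 1 := by
  have := length_le_of_minimalBinary (Y := subgrid a b p q X) hh hj (L.map (subgrid a b p q))
    (by simpa using fun V hV => (hL.1 V hV).minimal)
    (by simpa using fun V hV => (hL.1 V hV).mixedDiff)
    (by rw [List.pairwise_map]; exact hL.2)
  simpa using this

/-- Children of one parent are told apart by c, children of different parents by their parents, in
both cases through `Agree.of_extend`. -/
theorem Listing.extend {L : List (Mat ℤ)} (hp : 1 ≤ p) (hq : 1 ≤ q) (hj : 1 ≤ j) (hh : 1 ≤ h)
    (hL : Listing a b p q h j X L) :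
    Listing a b p q h (j + 1) X
      (forEach L [] fun V L' => forEach [-1, 0, 1] L' fun c L' => do
        match (← extend m n p q a b h j X c V) with
        | none => pure L'
        | some V' => push L' V').val := by
  rw [extendAll_val]
  constructor
  · intro V' hV'
    simp only [List.mem_flatMap, Option.mem_toList] at hV'
    obtain ⟨V, hV, c, -, hc⟩ := hV'
    exact (hL.1 V hV).extend hp hq hj hc
  · rw [List.pairwise_flatMap]
    refine ⟨fun V hV => ?_, hL.2.imp_of_mem fun {V W} hV hW hne V' hV' W' hW' he => ?_⟩
    · rw [List.pairwise_flatMap]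
      refine ⟨fun c _ => ?_, ?_⟩
      · cases (Microscope.extend m n p q a b h j X c V).val <;> simp
      · have : ([-1, 0, 1] : List ℤ).Pairwise (· ≠ ·) := by decide
        refine this.imp fun {c d} hcd V' hV' W' hW' he => hcd ?_
        rw [Option.mem_toList] at hV' hW'
        exact (Agree.of_extend hp hq hj hh (hL.1 V hV) (hL.1 V hV) hV' hW' he).2
    · simp only [List.mem_flatMap, Option.mem_toList] at hV' hW'
      obtain ⟨c, -, hc⟩ := hV'
      obtain ⟨d, -, hd⟩ := hW'
      exact hne (Agree.of_extend hp hq hj hh (hL.1 V hV) (hL.1 W hW) hc hd he).1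

theorem listing_zero (hh : 1 ≤ h) : Listing a b p q h 1 X [fun _ _ => 0] := by
  refine ⟨?_, by simp⟩
  simp only [List.mem_singleton, forall_eq]
  refine ⟨fun _ _ => le_rfl, ⟨fun _ _ _ _ => Or.inl rfl, fun i _ => ⟨1, by simp, rfl⟩,
    fun _ _ => ⟨1, by simp [hh], rfl⟩⟩, fun i k _ _ _ _ => by omega⟩

theorem minimalValuations_listing (hp : 1 ≤ p) (hq : 1 ≤ q) :
    Listing a b p q ((m - a) / p + 1) ((n - b) / q + 1) X
      (minimalValuations m n p q a b X).val := by
  simp only [minimalValuations, bind_val, lineCount_val, sub_val, alloc_val, push_val,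
    List.nil_append, Nat.add_sub_cancel]
  exact forRange_inv (fun j L => 1 ≤ j ∧ Listing a b p q ((m - a) / p + 1) j X L)
    (Nat.le_add_left _ _) ⟨le_rfl, listing_zero (Nat.le_add_left _ _)⟩
    (fun j L _ _ hL => ⟨Nat.le_add_left _ _, hL.2.extend hp hq hL.1 (Nat.le_add_left _ _)⟩) |>.2

end Listing

/-! ### Running time of the listing of minimal valuations -/

section Time
variable {N m n a b p q h j : ℕ} {X V : Mat ℤ} {c : ℤ}

@[simp] theorem ite_time {α : Type} (c : Prop) [Decidable c] (x y : Timed α) :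
    (if c then x else y).time = if c then x.time else y.time := apply_ite ..

theorem le_pow_two (N : ℕ) : N ≤ N ^ 2 := Nat.le_self_pow (by norm_num) N

theorem isZeroRow_time (hN : 1 ≤ N) (hj : j ≤ N) (r : ℕ) :
    (isZeroRow b q j r V).time ≤ 7 * N := by
  have := forRange_time_const (N := N) (c := 5) (lo := 1) (hi := j) (s := true)
    (body := fun c ok => do
      if (← same (← rd V r (← line b q c)) 0) then pure ok else pure false) hN (by omega)
    (fun i s => by simp)
  exact this

theorem hasFullColumn_time (hN : 1 ≤ N) (hj : j ≤ N) (hh : h ≤ N) :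
    (hasFullColumn a b p q h j V).time ≤ 12 * N ^ 2 := by
  refine forRange_time_linear (c := 10) hN (by omega) fun i s => ?_
  have := fun y => forRange_time_const (N := N) (c := 5) (lo := 1) (hi := h) (s := true)
    (body := fun i ok => do
        if (← same (← rd V (← line a p i) y) 1) then pure ok else pure false) hN (by omega)
    (fun i s => by simp)
  rw [bind_time, bind_time]
  have := this (line b q i).val
  simp only [ite_time, pure_time, line_time, ite_self] at this ⊢
  omega

theorem extend_time (hN : 1 ≤ N) (hmn : m * n ≤ N) (hj : j + 1 ≤ N) (hh : h ≤ N) :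
    (extend m n p q a b h j X c V).time ≤ 60 * N ^ 2 := by
  have hN2 := le_pow_two N
  rw [extend, bind_time, bind_time, bind_time, bind_time]
  simp only [copy_time, line_time, add_time, copy_val, line_val, add_val]
  -- A row costs at most one zero test (7N), one refill (6N) and a bounded number of further steps.
  have h1 := forRange_time_linear (N := N) (c := 30) (lo := 1) (hi := h) (s := (some V, c))
    (body := fun i (st : Option (Mat ℤ) × ℤ) =>
    match st with
    | (none, d) => pure (none, d)
    | (some V, d) => do
      let x ← line a p i
      let v ← add (← rd V x (b + (j - 1) * q)) d
      let d' ← if (← same i h) then pure d else add d (← rd X x (b + (j - 1) * q))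
      if (← same v 0) then
        pure (some (← wr V x (b + (j - 1) * q + q) 0), d')
      else if (← same v 1) then
        pure (some (← wr V x (b + (j - 1) * q + q) 1), d')
      else if (← same v (-1)) then
        if (← isZeroRow b q j x V) then
          let V ← forRange 1 j V fun c V => do wr V x (← line b q c) 1
          pure (some (← wr V x (b + (j - 1) * q + q) 0), d')
        else pure (none, d')
      else pure (none, d')) hN (by omega) (by
    rintro i ⟨_ | V, d⟩
    · simp
    have h1 := isZeroRow_time (b := b) (q := q) (V := V) hN (j := j) (by omega) (line a p i).val
    have h2 := forRange_time_const (N := N) (c := 4) (lo := 1) (hi := j) (s := V)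
      (body := fun c V => do wr V (line a p i).val (← line b q c) 1) hN (by omega)
      (fun i s => by simp)
    simp only [bind_time, line_time, rd_time, add_time, same_time, ite_time, wr_time,
      pure_time, line_val] at h1 h2 ⊢
    split_ifs <;> omega)
  generalize forRange 1 h (some V, c) _ = out at h1 ⊢
  rcases hout : out.val with ⟨_ | V1, d⟩
  · simp only [pure_time]
    omega
  · have h2 := hasFullColumn_time (a := a) (b := b) (p := p) (q := q) (V := V1) hN hj hh
    simp only [bind_time, add_time, ite_time, pure_time, ite_self, add_val]
    omega

/-- The bound on the lists enters here as a loop invariant: each intermediate list has at most h + 1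
≤ 2N members, each tried with three values of c, so that a column costs O(N^3). -/
theorem minimalValuations_time (hp : 1 ≤ p) (hq : 1 ≤ q) (hN : 1 ≤ N) (hmn : m * n ≤ N)
    (hm : 1 ≤ m) (hn : 1 ≤ n) (ha : 1 ≤ a) (hb : 1 ≤ b) :
    (minimalValuations m n p q a b X).time ≤ 1000 * N ^ 4 := by
  have hmN : m ≤ N := (Nat.le_mul_of_pos_right m hn).trans hmn
  have hnN : n ≤ N := (Nat.le_mul_of_pos_left n hm).trans hmn
  have hh : (m - a) / p + 1 ≤ N := by
    have := Nat.div_le_self (m - a) p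
    omega
  have hw : (n - b) / q + 1 ≤ N := by
    have := Nat.div_le_self (n - b) q
    omega
  simp only [minimalValuations, bind_time, lineCount_time, lineCount_val, sub_time, alloc_time,
    push_time, sub_val, alloc_val, push_val, List.nil_append, Nat.add_sub_cancel]
  generalize (m - a) / p = h at *
  generalize (n - b) / q = w at *
  have h1 := (forRange_time_inv (lo := 1) (hi := w) (s := [fun _ _ => (0 : ℤ)])
    (body := fun j L => forEach L [] fun V L' =>
      forEach [-1, 0, 1] L' fun c L' => do
      match (← extend m n p q a b (h + 1) j X c V) with
      | none => pure L'
      | some V' => push L' V') (t := 500 * N ^ 3)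
    (fun j L => 1 ≤ j ∧ Listing a b p q (h + 1) j X L)
    ⟨le_rfl, listing_zero (by omega)⟩
    (fun j L hj1 hj2 hL => ⟨⟨by omega, hL.2.extend hp hq hL.1 (by omega)⟩, by
      have hlen := hL.2.length_le (by omega) hj1
      have inner : ∀ (V : Mat ℤ) (L' : List (Mat ℤ)), (forEach [-1, 0, 1] L' fun c L' => do
        match (← extend m n p q a b (h + 1) j X c V) with
        | none => pure L'
        | some V' => push L' V').time ≤ 200 * N ^ 2 := by
        intro V L'
        refine (forEach_time (t := 60 * N ^ 2 + 1) fun c L' => ?_).trans ?_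
        · have := extend_time (X := X) (V := V) (c := c) (p := p) (q := q) (a := a) (b := b)
            hN hmn (j := j) (by omega) hh
          rw [bind_time]
          cases (extend m n p q a b (h + 1) j X c V).val <;> simp <;> omega
        · have : 1 ≤ N ^ 2 := Nat.one_le_pow _ _ hN
          simp only [List.length_cons, List.length_nil]
          omega
      refine (forEach_time inner).trans ?_
      have h2 : 1 ≤ N ^ 2 := Nat.one_le_pow _ _ hN
      have h3 : 1 ≤ N ^ 3 := Nat.one_le_pow _ _ hN
      calc L.length * (200 * N ^ 2 + 1) + 1 ≤ (2 * N) * (200 * N ^ 2 + N ^ 2) + N ^ 3 := by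
            gcongr; omega
        _ = 403 * N ^ 3 := by ring
        _ ≤ _ := by omega⟩)).trans (loop_le hN (by omega) le_rfl)
  have : N ≤ N ^ 4 := Nat.le_self_pow (by norm_num) N
  refine (Nat.add_le_add_left (Nat.add_le_add_left (Nat.add_le_add_left
    (Nat.add_le_add_left (Nat.add_le_add_left h1 _) _) _) _) _).trans ?_
  norm_num
  omega

end Time

/-- The size assumptions under which running times are bounded in terms of `N`. -/
structure Sizes (N m n p q : ℕ) : Prop where
  hp : 1 ≤ p
  hq : 1 ≤ q
  hpm : p ≤ m
  hqn : q ≤ n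
  hmn : m * n ≤ N

/-! ### Valuations of all subgrids, their sums, and the residual matrix -/

section Sums
variable {N m n p q : ℕ}

theorem Sizes.rows (h : Sizes N m n p q) : m ≤ N :=
  (Nat.le_mul_of_pos_right m (h.hq.trans h.hqn)).trans h.hmn

theorem Sizes.cols (h : Sizes N m n p q) : n ≤ N :=
  (Nat.le_mul_of_pos_left n (h.hp.trans h.hpm)).trans h.hmn

theorem Sizes.pos (h : Sizes N m n p q) : 1 ≤ N :=
  h.hp.trans (h.hpm.trans h.rows)

theorem Sizes.window (h : Sizes N m n p q) : p * q ≤ N :=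
  (Nat.mul_le_mul h.hpm h.hqn).trans h.hmn

theorem Sizes.swap (h : Sizes N m n p q) : Sizes N n m q p :=
  ⟨h.hq, h.hp, h.hqn, h.hpm, by rw [Nat.mul_comm]; exact h.hmn⟩

theorem Sizes.scan (h : Sizes N m n p q) : (m - p + 1) * (n - q + 1) ≤ N :=
  have := h.hp
  have := h.hq
  have := h.hpm
  have := h.hqn
  (Nat.mul_le_mul (by omega) (by omega)).trans h.hmn

theorem chi_time {m' n' : ℕ} {A : Mat ℤ} (hN : 1 ≤ N) (hm : m' ≤ N) (hn : n' ≤ N)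
    (hmn : m' * n' ≤ N) : (chi m' n' A).time ≤ 20 * N ^ 2 := by
  simp only [chi, bind_time, alloc_time, sub_time, sub_val]
  have := fun B => forRange_time_linear (N := N) (c := 12) (lo := 1) (hi := m' - 1) (s := B)
    (body := fun i X => forRange 1 (n' - 1) X fun j X => do
      let i1 ← add i 1
      let j1 ← add j 1
      let s ← add (← rd A i j) (← rd A i1 j1)
      let s ← sub s (← rd A i1 j)
      let s ← sub s (← rd A i j1)
      wr X i j s) hN (by omega)
      (fun i X => forRange_time_const hN (by omega) fun j X => by simp)
  have h2 := le_pow_two N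
  refine (Nat.add_le_add_left (Nat.add_le_add_left (Nat.add_le_add_left (this _) _) _) _).trans ?_
  omega

/-- A short sequence of nonnegative matrices. -/
def ShortNonneg (N : ℕ) (L : List (Mat ℤ)) : Prop :=
  L.length ≤ N ∧ ∀ V ∈ L, ∀ r c, 0 ≤ V r c

theorem minimalValuations_short (h : Sizes N m n p q) {a b : ℕ} (ha : 1 ≤ a) (X : Mat ℤ) :
    ShortNonneg (2 * N) (minimalValuations m n p q a b X).val := by
  have hL := minimalValuations_listing (m := m) (n := n) (a := a) (b := b) (X := X) h.hp h.hq
  refine ⟨(hL.length_le (Nat.le_add_left _ _) (Nat.le_add_left _ _)).trans ?_,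
    fun V hV => (hL.1 V hV).nonneg⟩
  have h1 := Nat.div_le_self (m - a) p
  have h2 := h.rows
  have h3 := h.hp.trans h.hpm
  generalize (m - a) / p = k at *
  omega

theorem allValuations_val (h : Sizes N m n p q) (X : Mat ℤ) :
    (allValuations m n p q X).val.length = p * q ∧
      ∀ L ∈ (allValuations m n p q X).val, ShortNonneg (2 * N) L := by
  have := forRange_inv (lo := 1) (hi := p) (s := [])
    (body := fun a Ls => forRange 1 q Ls fun b Ls => do
      push Ls (← minimalValuations m n p q a b X))
    -- Before round a the length is (a - 1)q; q is moved to the other side to avoid truncated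
    -- subtraction.
    (fun a Ls => Ls.length + q = a * q ∧ ∀ L ∈ Ls, ShortNonneg (2 * N) L) (by omega)
    (by simp) (fun a Ls ha _ hLs => by
      have := forRange_inv (lo := 1) (hi := q) (s := Ls)
        (body := fun b Ls => do push Ls (← minimalValuations m n p q a b X))
        (fun b Ls => Ls.length + q + 1 = a * q + b ∧ ∀ L ∈ Ls, ShortNonneg (2 * N) L) (by omega)
        ⟨by omega, hLs.2⟩ (fun b Ls _ _ hLs => by
          simp only [bind_val, push_val, List.length_append, List.length_singleton,
            List.mem_append, List.mem_singleton]
          refine ⟨by omega, ?_⟩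
          rintro L (hL | rfl)
          · exact hLs.2 L hL
          · exact minimalValuations_short h ha X)
      refine ⟨?_, this.2⟩
      rw [Nat.add_mul]
      omega)
  refine ⟨?_, this.2⟩
  have := this.1
  rw [Nat.add_mul] at this
  rw [allValuations]
  omega

theorem allValuations_time (h : Sizes N m n p q) (X : Mat ℤ) :
    (allValuations m n p q X).time ≤ 1005 * N ^ 6 := by
  have hN := h.pos
  have h4 : 1 ≤ N ^ 4 := Nat.one_le_pow _ _ hN
  have h1 := h.rows
  have h2 := h.cols
  have h3 := h.hpm
  have h5 := h.hqn
  refine (forRange_time_inv (t := 1003 * N ^ 5) (fun _ _ => True) trivial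
    fun a s ha _ _ => ⟨trivial, ?_⟩).trans (loop_le hN (by omega) le_rfl)
  refine (forRange_time_inv (t := 1001 * N ^ 4) (fun _ _ => True) trivial
    fun b s hb _ _ => ⟨trivial, ?_⟩).trans (loop_le hN (by omega) le_rfl)
  have := minimalValuations_time (X := X) h.hp h.hq hN h.hmn (h.hp.trans h.hpm)
    (h.hq.trans h.hqn) ha hb
  simp only [bind_time, push_time]
  omega

theorem addMat_time (h : Sizes N m n p q) (M V : Mat ℤ) : (addMat m n M V).time ≤ 12 * N ^ 2 := by
  have hN := h.pos
  have h1 := h.rows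
  have h2 := h.cols
  have h3 := h.hmn
  have h4 := le_pow_two N
  have := forRange_time_linear (N := N) (c := 6) (lo := 1) (hi := m) (s := (fun _ _ => (0 : ℤ) : Mat ℤ))
    (body := fun i S => forRange 1 n S fun j S => do
    wr S i j (← add (← rd M i j) (← rd V i j))) hN (by omega)
    (fun i X => forRange_time_const hN (by omega) fun j X => by simp)
  rw [addMat, bind_time]
  refine (Nat.add_le_add_left this _).trans ?_
  rw [alloc_time]
  omega

theorem addMat_nonneg {M V : Mat ℤ} (hM : ∀ r c, 0 ≤ M r c) (hV : ∀ r c, 0 ≤ V r c) :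
    ∀ r c, 0 ≤ (addMat m n M V).val r c := by
  rw [addMat, bind_val]
  refine forRange_inv (fun _ (S : Mat ℤ) => ∀ r c, 0 ≤ S r c) (Nat.le_add_left _ _) (fun _ _ => le_rfl)
    fun i S _ _ hS => ?_
  refine forRange_inv (fun _ (S : Mat ℤ) => ∀ r c, 0 ≤ S r c) (Nat.le_add_left _ _) hS fun j S _ _ hS r c => ?_
  simp only [bind_val, rd_val, add_val, wr_val]
  split_ifs
  · exact Int.add_nonneg (hM i j) (hV i j)
  · exact hS r c

theorem sums_step_val (L Ms : List (Mat ℤ)) :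
    (forEach Ms [] fun M acc => forEach L acc fun V acc => do push acc (← addMat m n M V)).val =
      Ms.flatMap fun M => L.flatMap fun V => [(addMat m n M V).val] := by
  rw [forEach_append_val fun M => L.flatMap fun V => [(addMat m n M V).val], List.nil_append]
  intro M s
  apply forEach_append_val
  intro V s
  simp

theorem sums_step_short {a b : ℕ} {L Ms : List (Mat ℤ)} (hL : ShortNonneg b L)
    (hMs : ShortNonneg a Ms) : ShortNonneg (a * b)
    (forEach Ms [] fun M acc => forEach L acc fun V acc => do
      push acc (← addMat m n M V)).val := by
  rw [sums_step_val]
  constructor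
  · simp only [List.length_flatMap, List.length_singleton, List.map_const', List.sum_replicate,
      smul_eq_mul, mul_one]
    exact Nat.mul_le_mul hMs.1 hL.1
  · intro W hW
    simp only [List.mem_flatMap, List.mem_singleton] at hW
    obtain ⟨M, hM, V, hV, rfl⟩ := hW
    exact addMat_nonneg (hMs.2 M hM) (hL.2 V hV)

theorem sums_step_time (h : Sizes N m n p q) {S : ℕ} {L Ms : List (Mat ℤ)}
    (hL : ShortNonneg (2 * N) L) (hS : 1 ≤ S) (hMs : Ms.length ≤ S) :
    (forEach Ms [] fun M acc => forEach L acc fun V acc => do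
      push acc (← addMat m n M V)).time ≤ 40 * (S * N ^ 3) := by
  have hN := h.pos
  have h2 : 1 ≤ N ^ 2 := Nat.one_le_pow _ _ hN
  have h3 : 1 ≤ N ^ 3 := Nat.one_le_pow _ _ hN
  have h4 : 1 ≤ S * N ^ 3 := Nat.mul_pos hS h3
  refine (forEach_time (t := 30 * N ^ 3) fun M acc => ?_).trans ?_
  · refine (forEach_time (t := 13 * N ^ 2) fun V acc => ?_).trans ?_
    · have := addMat_time h M V
      simp only [bind_time, push_time]
      omega
    · calc L.length * (13 * N ^ 2 + 1) + 1 ≤ (2 * N) * (13 * N ^ 2 + N ^ 2) + N ^ 3 := by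
            gcongr; exact hL.1
        _ = 29 * N ^ 3 := by ring
        _ ≤ _ := by omega
  · calc Ms.length * (30 * N ^ 3 + 1) + 1 ≤ S * (30 * N ^ 3 + N ^ 3) + S * N ^ 3 := by gcongr
      _ = 32 * (S * N ^ 3) := by ring
      _ ≤ _ := by omega

/-- The induction is over the lists still to be used. The number S bounds the final product of
lengths, hence also every intermediate list, since no factor is below 1. -/
theorem sums_loop (h : Sizes N m n p q) {a S : ℕ} (hS : 1 ≤ S) {Ls : List (List (Mat ℤ))}
    (hLs : ∀ L ∈ Ls, ShortNonneg (2 * N) L) {Ms : List (Mat ℤ)} (hMs : ShortNonneg a Ms)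
    (ha : a * (2 * N) ^ Ls.length ≤ S) :
    ShortNonneg S (forEach Ls Ms fun L Ms => forEach Ms [] fun M acc =>
      forEach L acc fun V acc => do push acc (← addMat m n M V)).val ∧
    (forEach Ls Ms fun L Ms => forEach Ms [] fun M acc =>
      forEach L acc fun V acc => do push acc (← addMat m n M V)).time ≤
        Ls.length * (40 * (S * N ^ 3) + 1) + 1 := by
  have hN := h.pos
  induction Ls generalizing Ms a with
  | nil =>
    simp only [List.length_nil, pow_zero, mul_one] at ha
    exact ⟨⟨hMs.1.trans ha, hMs.2⟩, by simp [forEach]⟩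
  | cons L Ls ih =>
    have hL := hLs L (by simp)
    have h1 := sums_step_short (m := m) (n := n) hL hMs
    have h2 := ih (fun K hK => hLs K (by simp [hK])) h1 (by
      rwa [List.length_cons, pow_succ', ← mul_assoc] at ha)
    have h3 := sums_step_time h hL hS (hMs.1.trans ((Nat.le_mul_of_pos_right a
      (Nat.pow_pos (by omega))).trans ha))
    simp only [forEach, bind_val, bind_time, tick_time, List.length_cons, Nat.add_mul,
      Nat.one_mul] at h2 h3 ⊢
    exact ⟨h2.1, by have := h2.2; omega⟩

/-- The only list whose bound has an exponent of N depending on p and q: pq factors of size 2N each.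
-/
theorem allSums_spec (h : Sizes N m n p q) {Ls : List (List (Mat ℤ))}
    (hlen : Ls.length = p * q) (hLs : ∀ L ∈ Ls, ShortNonneg (2 * N) L) :
    ShortNonneg ((2 * N) ^ (p * q)) (allSums m n Ls).val ∧
      (allSums m n Ls).time ≤ 60 * ((2 * N) ^ (p * q) * N ^ 4) := by
  have hN := h.pos
  have hS : 1 ≤ (2 * N) ^ (p * q) := Nat.pow_pos (by omega)
  have := sums_loop h hS hLs (Ms := [fun _ _ => 0]) (a := 1) ⟨by simp, by simp⟩
    (by rw [hlen, one_mul])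
  rw [hlen] at this
  simp only [allSums, bind_val, bind_time, alloc_val, alloc_time, push_val, push_time,
    List.nil_append] at this ⊢
  refine ⟨this.1, (Nat.add_le_add_left (Nat.add_le_add_left this.2 _) _).trans ?_⟩
  generalize (2 * N) ^ (p * q) = S at *
  have h1 := loop_le (c := 40 * S) (k := 3) hN h.window le_rfl
  have h2 : N ≤ N ^ 4 := Nat.le_self_pow (by norm_num) N
  have h3 : N ^ 4 ≤ S * N ^ 4 := Nat.le_mul_of_pos_left _ hS
  have h4 := h.hmn
  calc _ ≤ N + 1 + (1 + (40 * S + 2) * N ^ 4) := by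
        rw [show 40 * (S * N ^ 3) = 40 * S * N ^ 3 by ring]; gcongr
    _ = N + 2 + (40 * (S * N ^ 4) + 2 * N ^ 4) := by ring
    _ ≤ _ := by omega

/-- Subtracting nonnegative entries can only lower A. Nonnegativity of K takes care of the cells
still holding their initial 0. -/
theorem residual_le {m' n' : ℕ} {K : ℤ} {A M : Mat ℤ} (hK : 0 ≤ K) (hA : ∀ i j, A i j ≤ K)
    (hM : ∀ r c, 0 ≤ M r c) : ∀ i j, (residual m' n' p q A M).val i j ≤ K := by
  simp only [residual, bind_val, alloc_val, sub_val]
  refine forRange_inv (fun _ (S : Mat ℤ) => ∀ r c, S r c ≤ K) (Nat.le_add_left _ _) (fun _ _ => hK)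
    fun i S _ _ hS => ?_
  refine forRange_inv (fun _ (S : Mat ℤ) => ∀ r c, S r c ≤ K) (Nat.le_add_left _ _) hS fun j S _ _ hS r c => ?_
  simp only [bind_val, rd_val, wr_val]
  split_ifs
  · refine forRange_inv (fun _ (s : ℤ) => s ≤ K) (Nat.zero_le _) (hA i j) fun r s _ _ hs => ?_
    refine forRange_inv (fun _ (s : ℤ) => s ≤ K) (Nat.zero_le _) hs fun c s _ _ hs => ?_
    have := hM (i + r) (j + c)
    simp only [bind_val, add_val, rd_val, sub_val]
    omega
  · exact hS r c

theorem residual_time {m' n' : ℕ} (h : Sizes N m n p q) (hm : m' ≤ N) (hn : n' ≤ N)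
    (hmn : m' * n' ≤ N) (A M : Mat ℤ) : (residual m' n' p q A M).time ≤ 20 * N ^ 4 := by
  have hN := h.pos
  have h1 := h.rows
  have h2 := h.cols
  have h3 := h.hpm
  have h5 := h.hqn
  have h6 : N ≤ N ^ 4 := Nat.le_self_pow (by norm_num) N
  have h7 : 1 ≤ N ^ 2 := Nat.one_le_pow _ _ hN
  simp only [residual, bind_time, alloc_time, sub_time, sub_val, alloc_val]
  have key := fun B => forRange_time_le (N := N) (c := 12) (k := 3) (lo := 1) (hi := m') (s := B)
    (body := fun i B => forRange 1 n' B fun j B => do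
      let s ← forRange 0 (p - 1) (← rd A i j) fun r s => forRange 0 (q - 1) s fun c s => do
        sub s (← rd M (← add i r) (← add j c))
      wr B i j s) hN (by omega) fun i B =>
      forRange_time_le (c := 10) (k := 2) hN (by omega) fun j B => by
        have := forRange_time_linear (N := N) (c := 6) (lo := 0) (hi := p - 1) (s := A i j)
          (body := fun r s => forRange 0 (q - 1) s fun c s => do
            sub s (← rd M (← add i r) (← add j c))) hN (by have := h.hp; omega)
          (fun i X => forRange_time_const hN (by have := h.hq; omega) fun j X => by simp)
        simp only [bind_time, rd_time, rd_val, wr_time] at this ⊢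
        omega
  refine (Nat.add_le_add_left (Nat.add_le_add_left (Nat.add_le_add_left (key _) _) _) _).trans ?_
  norm_num
  omega

end Sums

/-! ### Running time of merging -/

section Merge
variable {N m n p q i j : ℕ}

theorem clearColumn_time (hN : 1 ≤ N) (hm : m ≤ N) (s : Cell) (M : Mat Cell) :
    (clearColumn m j s M).time ≤ 5 * N :=
  forRange_time_const (c := 3) hN (by omega) fun i N => by
    simp only [bind_time, rd_time, same_time, ite_time, wr_time, pure_time]; split_ifs <;> omega

theorem clearRow_time (hN : 1 ≤ N) (hn : n ≤ N) (s : Cell) (M : Mat Cell) :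
    (clearRow n i s M).time ≤ 5 * N :=
  forRange_time_const (c := 3) hN (by omega) fun i N => by
    simp only [bind_time, rd_time, same_time, ite_time, wr_time, pure_time]; split_ifs <;> omega

theorem occursInColumn_time (hN : 1 ≤ N) (hm : m ≤ N) (s : Cell) (M : Mat Cell) :
    (occursInColumn m j s M).time ≤ 4 * N :=
  forRange_time_const (c := 2) hN (by omega) fun i N => by simp

theorem occursInRow_time (hN : 1 ≤ N) (hn : n ≤ N) (s : Cell) (M : Mat Cell) :
    (occursInRow n i s M).time ≤ 4 * N :=
  forRange_time_const (c := 2) hN (by omega) fun i N => by simp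

theorem columnFree_time (hN : 1 ≤ N) (hm : m ≤ N) (M : Mat ℤ) :
    (columnFree m p i j M).time ≤ 11 * N := by
  have := forRange_time_const (c := 6) (lo := 1) (hi := m) (s := true)
    (body := fun i' ok => do
      if (← same (← res i' p) (res i p).val) then
        if (← same (← rd M i' j) 0) then pure ok else pure false
      else pure ok) hN (by omega) fun i N => by
        simp only [bind_time, rd_time, same_time, ite_time, res_time, pure_time]
        split_ifs <;> omega
  rw [columnFree, bind_time, res_time]
  omega

theorem rowFree_time (hN : 1 ≤ N) (hn : n ≤ N) (M : Mat ℤ) :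
    (rowFree n q i j M).time ≤ 11 * N := by
  have := forRange_time_const (c := 6) (lo := 1) (hi := n) (s := true)
    (body := fun j' ok => do
      if (← same (← res j' q) (res j q).val) then
        if (← same (← rd M i j') 0) then pure ok else pure false
      else pure ok) hN (by omega) fun i N => by
        simp only [bind_time, rd_time, same_time, ite_time, res_time, pure_time]
        split_ifs <;> omega
  rw [rowFree, bind_time, res_time]
  omega

theorem setColumn_time {α : Type} (hN : 1 ≤ N) (hm : m ≤ N) (x : α) (M : Mat α) :
    (setColumn m p i j x M).time ≤ 10 * N := by
  have := forRange_time_const (c := 5) (lo := 1) (hi := m) (s := M)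
    (body := fun i' M => do
      if (← same (← res i' p) (res i p).val) then wr M i' j x else pure M) hN (by omega)
      fun i N => by
        simp only [bind_time, same_time, ite_time, res_time, wr_time, pure_time]
        split_ifs <;> omega
  rw [setColumn, bind_time, res_time]
  omega

theorem setRow_time {α : Type} (hN : 1 ≤ N) (hn : n ≤ N) (x : α) (M : Mat α) :
    (setRow n q i j x M).time ≤ 10 * N := by
  have := forRange_time_const (c := 5) (lo := 1) (hi := n) (s := M)
    (body := fun j' M => do
      if (← same (← res j' q) (res j q).val) then wr M i j' x else pure M) hN (by omega)
      fun i N => by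
        simp only [bind_time, same_time, ite_time, res_time, wr_time, pure_time]
        split_ifs <;> omega
  rw [setRow, bind_time, res_time]
  omega

/-- Each position triggers a bounded number of passes along a single row or column. -/
theorem merge_time (h : Sizes N m n p q) (M : Mat ℤ) (C : Mat Cell) :
    (merge m n p q M C).time ≤ 40 * N ^ 3 := by
  have hN := h.pos
  have hm := h.rows
  have hn := h.cols
  have h3 := h.hmn
  have h6 : N ≤ N ^ 3 := Nat.le_self_pow (by norm_num) N
  rw [merge, bind_time, bind_time, copy_time, copy_time, bind_time]
  refine (Nat.add_le_add_left (Nat.add_le_add_left (Nat.add_le_add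
    (forRange_time_le (c := 32) (k := 2) hN (by omega) fun i st =>
      forRange_time_linear (c := 30) hN (by omega) fun j st => ?_)
    (Nat.le_of_eq (m := 0) ?_)) _) _).trans ?_
  · rcases st with _ | ⟨M, C⟩
    · simp
    rw [bind_time, rd_time, rd_val]
    rcases C i j with _ | _ | _ | k | k
    · simp only [pure_time]; omega
    · simp only [bind_time, rd_time, same_time, ite_time, wr_time, pure_time]; split_ifs <;> omega
    · simp only [bind_time, rd_time, same_time, ite_time, wr_time, pure_time]; split_ifs <;> omega
    · have t1 := columnFree_time (p := p) (i := i) (j := j) hN hm M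
      have t2 := setColumn_time (p := p) (i := i) (j := j) hN hm 1 M
      have t3 := clearColumn_time (j := j) hN hm (Cell.oneP k) C
      have t4 := setColumn_time (p := p) (i := i) (j := j) hN hm Cell.zero C
      have t5 := occursInColumn_time (j := j) hN hm (Cell.oneP k)
        (setColumn m p i j Cell.zero C).val
      simp only [bind_time, ite_time, pure_time, ite_self]
      split_ifs <;> omega
    · have t1 := rowFree_time (q := q) (i := i) (j := j) hN hn M
      have t2 := setRow_time (q := q) (i := i) (j := j) hN hn 1 M
      have t3 := clearRow_time (i := i) hN hn (Cell.oneQ k) C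
      have t4 := setRow_time (q := q) (i := i) (j := j) hN hn Cell.zero C
      have t5 := occursInRow_time (i := i) hN hn (Cell.oneQ k)
        (setRow n q i j Cell.zero C).val
      simp only [bind_time, ite_time, pure_time, ite_self]
      split_ifs <;> omega
  · split <;> rfl
  · norm_num
    omega

end Merge

/-! ### Joint reasoning about values and running times -/

section Sat
variable {α β σ : Type}

/-- The computation `x` takes at most `t` steps and its value satisfies `Q`. -/
def Timed.Sat (x : Timed α) (t : ℕ) (Q : α → Prop) : Prop := Q x.val ∧ x.time ≤ t

/-- The cost of a continuation depends on the value it receives, so a postcondition of the first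
part has to be available when the second is timed. -/
theorem Timed.Sat.bind {x : Timed α} {f : α → Timed β} {t u : ℕ} {Q : α → Prop} {R : β → Prop}
    (hx : x.Sat t Q) (hf : ∀ a, Q a → (f a).Sat u R) : (x >>= f).Sat (t + u) R :=
  ⟨(hf _ hx.1).1, Nat.add_le_add hx.2 (hf _ hx.1).2⟩

theorem Timed.Sat.mono {x : Timed α} {t u : ℕ} {Q R : α → Prop} (hx : x.Sat t Q) (htu : t ≤ u)
    (hQ : ∀ a, Q a → R a) : x.Sat u R :=
  ⟨hQ _ hx.1, hx.2.trans htu⟩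

theorem Timed.Sat.pure {a : α} {t : ℕ} {Q : α → Prop} (h : Q a) : (Pure.pure a : Timed α).Sat t Q :=
  ⟨h, Nat.zero_le t⟩

theorem forRange_sat {N c k lo hi : ℕ} {s : σ} {body : ℕ → σ → Timed σ} (I : ℕ → σ → Prop)
    (hN : 1 ≤ N) (hlo : lo ≤ hi + 1) (hu : hi + 1 - lo ≤ N) (h0 : I lo s)
    (hb : ∀ i s, lo ≤ i → i ≤ hi → I i s → (body i s).Sat (c * N ^ k) (I (i + 1))) :
    (forRange lo hi s body).Sat ((c + 2) * N ^ (k + 1)) (I (hi + 1)) :=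
  ⟨forRange_inv I hlo h0 fun i s h1 h2 h3 => (hb i s h1 h2 h3).1,
    (forRange_time_inv I h0 hb).trans (loop_le hN hu le_rfl)⟩

end Sat

/-! ### Decomposition into constant rows and constant columns -/

section Decompose
variable {N m' n' : ℕ} {A : Mat ℤ}

/-- Only the first row of the matrix influences the (1,1) entries that are needed later, so
minimality is recorded for that row alone. -/
theorem minimum_sat (hN : 1 ≤ N) (hm : m' ≤ N) (hn : n' ≤ N) :
    (forRange 1 m' (A 1 1) fun i k => forRange 1 n' k fun j k => do
      let x ← rd A i j
      if (← leq k x) then pure k else pure x).Sat (6 * N ^ 2)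
      fun k => k ≤ A 1 1 ∧ (1 ≤ m' → ∀ j, 1 ≤ j → j ≤ n' → k ≤ A 1 j) := by
  refine (forRange_sat (N := N) (c := 4) (k := 1)
    (fun i k => k ≤ A 1 1 ∧ (1 < i → ∀ j, 1 ≤ j → j ≤ n' → k ≤ A 1 j)) hN
    (Nat.le_add_left _ _) (by omega) ⟨le_rfl, by omega⟩ fun i k hi _ hk => ?_).mono (by simp)
    fun k hk => ⟨hk.1, fun h => hk.2 (by omega)⟩
  refine (forRange_sat (N := N) (c := 2) (k := 0)
    (fun j k' => k' ≤ k ∧ ∀ j', 1 ≤ j' → j' < j → k' ≤ A i j') hN (Nat.le_add_left _ _)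
    (by omega) ⟨le_rfl, by omega⟩ fun j k' _ _ hk' => ⟨?_, by simp⟩).mono (by simp)
    fun k' hk' => ⟨hk'.1.trans hk.1, fun hi j h1 h2 => ?_⟩
  · simp only [bind_val, rd_val, leq_val, ite_val, pure_val, decide_eq_true_eq]
    split_ifs with h
    · refine ⟨hk'.1, fun j' h1 h2 => ?_⟩
      rcases eq_or_lt_of_le (Nat.lt_succ_iff.1 h2) with rfl | hlt
      · exact h
      · exact hk'.2 j' h1 hlt
    · refine ⟨(not_le.1 h).le.trans hk'.1, fun j' h1 h2 => ?_⟩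
      rcases eq_or_lt_of_le (Nat.lt_succ_iff.1 h2) with rfl | hlt
      · exact le_rfl
      · exact (not_le.1 h).le.trans (hk'.2 j' h1 hlt)
  · by_cases hi1 : i = 1
    · subst hi1
      exact hk'.2 j h1 (by omega)
    · exact hk'.1.trans (hk.2 (by omega) j h1 h2)

theorem shift_sat (hN : 1 ≤ N) (hm : m' ≤ N) (hn : n' ≤ N) {k : ℤ} (hk : k ≤ A 1 1)
    (hk' : 1 ≤ m' → ∀ j, 1 ≤ j → j ≤ n' → k ≤ A 1 j) :
    (forRange 1 m' (fun _ _ => (0 : ℤ)) fun i (Ac : Mat ℤ) => forRange 1 n' Ac fun j Ac => do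
      wr Ac i j (← sub (← rd A i j) k)).Sat (7 * N ^ 2)
      fun Ac => (∀ j, 0 ≤ Ac 1 j) ∧ Ac 1 1 ≤ A 1 1 - k := by
  refine (forRange_sat (N := N) (c := 5) (k := 1)
    (fun _ (Ac : Mat ℤ) => (∀ j, 0 ≤ Ac 1 j) ∧ Ac 1 1 ≤ A 1 1 - k) hN (Nat.le_add_left _ _)
    (by omega) ⟨fun _ => le_rfl, by simpa using hk⟩ fun i Ac hi hi' hAc => ?_).mono (by simp)
    fun _ h => h
  refine (forRange_sat (N := N) (c := 3) (k := 0)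
    (fun _ (Ac : Mat ℤ) => (∀ j, 0 ≤ Ac 1 j) ∧ Ac 1 1 ≤ A 1 1 - k) hN (Nat.le_add_left _ _)
    (by omega) hAc fun j Ac hj hj' hAc => ⟨⟨fun j' => ?_, ?_⟩, by simp⟩).mono (by simp)
    fun _ h => h
  · simp only [bind_val, rd_val, sub_val, wr_val]
    split_ifs with h
    · rw [← h.1]
      have := hk' (by omega) j hj hj'
      omega
    · exact hAc.1 j'
  · simp only [bind_val, rd_val, sub_val, wr_val]
    split_ifs with h
    · rw [← h.1, ← h.2]
    · exact hAc.2

/-- The minimum of the first row lies between 0 and its first entry. Moving it to the other part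
therefore leaves both (1,1) entries at most a. The sign of the first row is used only in the pass i
= 1, hence the form of the invariant. -/
theorem split_rows_sat (hN : 1 ≤ N) (hm : m' ≤ N) (hn : n' ≤ N) {a : ℤ} (ha : 0 ≤ a)
    {Ac : Mat ℤ} (hAc : ∀ j, 0 ≤ Ac 1 j) (hAc' : Ac 1 1 ≤ a) :
    (forRange 1 m' (((fun _ _ => (0 : ℤ)), Ac) : Mat ℤ × Mat ℤ) fun i st => do
    let ki ← forRange 1 n' (← rd st.2 i 1) fun j ki => do
      let x ← rd st.2 i j
      if (← leq ki x) then pure ki else pure x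
    forRange 1 n' st fun j st => do
      let Ac ← wr st.2 i j (← sub (← rd st.2 i j) ki)
      let Ar ← wr st.1 i j ki
      pure (Ar, Ac)).Sat (20 * N ^ 2) fun st => st.1 1 1 ≤ a ∧ st.2 1 1 ≤ a := by
  refine (forRange_sat (N := N) (c := 11) (k := 1)
    (fun i (st : Mat ℤ × Mat ℤ) => (i = 1 → ∀ j, 0 ≤ st.2 1 j) ∧ st.1 1 1 ≤ a ∧ st.2 1 1 ≤ a) hN
    (Nat.le_add_left _ _) (by omega) ⟨fun _ => hAc, ha, hAc'⟩ fun i st hi _ hst => ?_).mono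
    (by rw [Nat.pow_succ, pow_one, ← pow_two]; omega) fun _ h => h.2
  refine ((show (rd st.2 i 1).Sat 1 fun x => i = 1 → 0 ≤ x ∧ x ≤ a from
    ⟨?_, le_rfl⟩).bind fun x hx => ((forRange_sat (N := N) (c := 2) (k := 0)
    (fun _ x => i = 1 → 0 ≤ x ∧ x ≤ a) hN (Nat.le_add_left _ _) (by omega) hx
    fun j x _ _ hx => ⟨?_, by simp⟩).bind (u := 6 * N) fun ki hki => (forRange_sat (N := N) (c := 4)
    (k := 0) (fun _ (st : Mat ℤ × Mat ℤ) => st.1 1 1 ≤ a ∧ st.2 1 1 ≤ a) hN (Nat.le_add_left _ _)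
    (by omega) hst.2 fun j st _ _ hst => ⟨?_, by simp⟩).mono (by simp)
    fun st hst => ⟨by omega, hst⟩)).mono (by simp only [zero_add, pow_one]; omega) fun _ h => h
  · rintro rfl
    exact ⟨hst.1 rfl 1, hst.2.2⟩
  · rintro rfl
    have h0 := hst.1 rfl j
    have := hx rfl
    simp only [bind_val, rd_val, leq_val, ite_val, pure_val, decide_eq_true_eq]
    split_ifs <;> omega
  · simp only [bind_val, rd_val, sub_val, wr_val, pure_val]
    constructor
    · split_ifs with h
      · exact (hki h.1.symm).2
      · exact hst.1
    · split_ifs with h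
      · have := (hki h.1.symm).1
        rw [← h.1, ← h.2]
        have := hst.2
        omega
      · exact hst.2

/-- After the shift by k both (1,1) entries are at most A[1,1] - k; adding back t or k - t with 0 ≤
t ≤ k keeps them at most A[1,1]. There are k + 1 ≤ K + 1 ≤ 2N decompositions. -/
theorem decompose_sat {K : ℕ} (hN : 1 ≤ N) (hm : m' ≤ N) (hn : n' ≤ N) (hmn : m' * n' ≤ N)
    (hK : K ≤ N) (hA : A 1 1 ≤ K) :
    (decompose m' n' A).Sat (100 * N ^ 3) fun D =>
      D.length ≤ 2 * N ∧ ∀ AA ∈ D, AA.1 1 1 ≤ K ∧ AA.2 1 1 ≤ K := by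
  have h2 : N ≤ N ^ 3 := Nat.le_self_pow (by norm_num) N
  have h3 : N ^ 2 ≤ N ^ 3 := Nat.pow_le_pow_right hN (by norm_num)
  have h4 := le_pow_two N
  have hal : (alloc m' n' (0 : ℤ)).Sat (N + 1) fun M => M = fun _ _ => 0 :=
    ⟨rfl, by rw [alloc_time]; omega⟩
  rw [decompose]
  refine ((show (rd A 1 1).Sat 1 fun x => x = A 1 1 from ⟨rfl, le_rfl⟩).bind
    (u := 99 * N ^ 3) ?_).mono (by omega) fun _ h => h
  rintro _ rfl
  refine ((minimum_sat hN hm hn).bind (u := 93 * N ^ 3) fun k hk => ?_).mono (by omega) fun _ h => h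
  refine (hal.bind (u := 91 * N ^ 3) ?_).mono (by omega) fun _ h => h
  rintro _ rfl
  refine (hal.bind (u := 89 * N ^ 3) ?_).mono (by omega) fun _ h => h
  rintro _ rfl
  refine ((shift_sat hN hm hn hk.1 hk.2).bind (u := 82 * N ^ 3) fun Ac hAc => ?_).mono (by omega)
    fun _ h => h
  refine ((split_rows_sat hN hm hn (a := A 1 1 - k) (by omega) hAc.1 hAc.2).bind (u := 62 * N ^ 3)
    ?_).mono (by omega) fun _ h => h
  rintro ⟨Ar, Ac⟩ ⟨hAr, hAc⟩
  dsimp only at hAr hAc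
  refine Timed.Sat.bind (t := 10 * N ^ 2) (u := 52 * N ^ 3) (Q := fun _ => True) ⟨trivial, ?_⟩
    (fun ok _ => ?_) |>.mono (by omega) fun _ h => h
  · exact (forRange_time_linear (N := N) (c := 6) hN (by omega) fun i ok =>
      forRange_time_const (c := 4) hN (by omega) fun j ok => by simp).trans (by omega)
  split_ifs
  swap
  · exact Timed.Sat.pure (by simp)
  refine Timed.Sat.bind (t := 1) (u := 51 * N ^ 3) (Q := fun b => b = true → 0 ≤ k)
    ⟨by simp, le_rfl⟩ (fun ok hk0 => ?_) |>.mono (by omega) fun _ h => h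
  split_ifs with hok
  swap
  · exact Timed.Sat.pure (by simp)
  replace hk0 := hk0 hok
  obtain ⟨l, rfl⟩ := Int.eq_ofNat_of_zero_le hk0
  rw [Int.toNat_natCast]
  -- Since t runs from 0, the list has at most t elements before round t, so l + 1 at the end, with
  -- l ≤ A[1,1] ≤ K.
  have step : ∀ (t : ℕ) (L : List (Mat ℤ × Mat ℤ)), t ≤ l →
      (L.length ≤ t ∧ ∀ AA ∈ L, AA.1 1 1 ≤ K ∧ AA.2 1 1 ≤ K) →
      Timed.Sat (do
        let Rt ← alloc m' n' (0 : ℤ)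
        let Ct ← alloc m' n' (0 : ℤ)
        let kt ← sub (l : ℤ) (t : ℤ)
        let (Rt, Ct) ← forRange 1 m' (Rt, Ct) fun i st => forRange 1 n' st fun j st => do
          let Rt ← wr st.1 i j (← add (← rd Ar i j) (t : ℤ))
          let Ct ← wr st.2 i j (← add (← rd Ac i j) kt)
          pure (Rt, Ct)
        push L (Rt, Ct)) (20 * N ^ 2) fun L' =>
          L'.length ≤ t + 1 ∧ ∀ AA ∈ L', AA.1 1 1 ≤ K ∧ AA.2 1 1 ≤ K := by
    intro t L ht hL
    refine (hal.bind (u := 18 * N ^ 2) ?_).mono (by omega) fun _ h => h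
    rintro _ rfl
    refine (hal.bind (u := 16 * N ^ 2) ?_).mono (by omega) fun _ h => h
    rintro _ rfl
    refine (Timed.Sat.bind (t := 1) (u := 15 * N ^ 2) (Q := fun kt => kt = (l : ℤ) - t)
      ⟨rfl, le_rfl⟩ ?_).mono (by omega) fun _ h => h
    rintro _ rfl
    refine (Timed.Sat.bind (t := 10 * N ^ 2) (u := 1)
      (Q := fun st : Mat ℤ × Mat ℤ => st.1 1 1 ≤ K ∧ st.2 1 1 ≤ K) ?_ ?_).mono (by omega)
      fun _ h => h
    · refine (forRange_sat (N := N) (c := 8) (k := 1)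
        (fun _ (st : Mat ℤ × Mat ℤ) => st.1 1 1 ≤ K ∧ st.2 1 1 ≤ K) hN (Nat.le_add_left _ _)
        (by omega) ⟨by simp, by simp⟩ fun i st _ _ hst => ?_).mono (by simp) fun _ h => h
      refine (forRange_sat (N := N) (c := 6) (k := 0)
        (fun _ (st : Mat ℤ × Mat ℤ) => st.1 1 1 ≤ K ∧ st.2 1 1 ≤ K) hN (Nat.le_add_left _ _)
        (by omega) hst fun j st _ _ hst => ⟨?_, by simp⟩).mono (by simp) fun _ h => h
      simp only [bind_val, rd_val, add_val, wr_val, pure_val]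
      constructor
      · split_ifs with h
        · rw [← h.1, ← h.2]; omega
        · exact hst.1
      · split_ifs with h
        · rw [← h.1, ← h.2]; omega
        · exact hst.2
    · rintro ⟨R, C⟩ hRC
      refine ⟨?_, le_rfl⟩
      simp only [push_val, List.length_append, List.length_singleton, List.mem_append,
        List.mem_singleton]
      refine ⟨by omega, ?_⟩
      rintro AA (hAA | rfl)
      · exact hL.2 AA hAA
      · exact hRC
  constructor
  · have := (forRange_inv (s := []) (fun t (L : List (Mat ℤ × Mat ℤ)) =>
      L.length ≤ t ∧ ∀ AA ∈ L, AA.1 1 1 ≤ K ∧ AA.2 1 1 ≤ K) (Nat.zero_le _) (by simp)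
      fun t L _ ht hL => (step t L ht hL).1)
    exact ⟨this.1.trans (by omega), this.2⟩
  · refine (forRange_time_inv (t := 20 * N ^ 2) (fun t (L : List (Mat ℤ × Mat ℤ)) =>
      L.length ≤ t ∧ ∀ AA ∈ L, AA.1 1 1 ≤ K ∧ AA.2 1 1 ≤ K) (by simp)
      fun t L _ ht hL => step t L ht hL).trans ?_
    have h5 : 1 ≤ N ^ 2 := Nat.one_le_pow _ _ hN
    calc (l + 1 - 0) * (20 * N ^ 2 + 1) + 1 ≤ (2 * N) * (20 * N ^ 2 + N ^ 2) + N ^ 3 := by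
          gcongr <;> omega
      _ = 43 * N ^ 3 := by ring
      _ ≤ _ := by omega

end Decompose

/-! ### First step for constant rows: counts stay nonnegative -/

section ConstRows
variable {N m n p q : ℕ} {A : Mat ℤ} {K : ℕ}

/-- The allowance N + 1 covers a start at cell 0, which occurs when a negative bound is truncated;
the time bound then needs no sign information. -/
theorem fillRow_time (i : ℕ) {lo hi : ℕ} (hu : hi + 1 - lo ≤ N + 1) (M : Mat ℤ) :
    (fillRow i lo hi M).time ≤ 2 * N + 3 := by
  refine (forRange_time (t := 1) fun j M => by simp).trans ?_
  omega

/-- An entry is either set to e - d with d ≤ e or increased by d - e with d > e, so the counts never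
become negative. Hence k, which is A[1,1] minus p of them, is at most A[1,1]. The test against q
keeps each filling linear in N. -/
theorem recConstRows₁_sat (h : Sizes N m n p q) (hA : A 1 1 ≤ K) :
    (recConstRows₁ (m - p + 1) (n - q + 1) p q A).Sat (60 * N ^ 3) fun out =>
      ∀ M e k, out = some (M, e, k) → k ≤ K := by
  have hN := h.pos
  have h0 := h.rows
  have h1 := h.cols
  have hp := h.hp
  have hq := h.hq
  have hpm := h.hpm
  have hqn := h.hqn
  have hmn := h.hmn
  have h2 : N ≤ N ^ 3 := Nat.le_self_pow (by norm_num) N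
  have h3 : N ^ 2 ≤ N ^ 3 := Nat.pow_le_pow_right hN (by norm_num)
  have h4 := le_pow_two N
  simp only [recConstRows₁]
  -- The scan has m - p + 1 rows, so adding p and subtracting 1 recovers m because p ≤ m; similarly
  -- for n.
  refine (Timed.Sat.bind (t := 1) (u := 59 * N ^ 3) (Q := fun x => x = m + 1)
    ⟨by simp; omega, by simp⟩ ?_).mono (by omega) fun _ h => h
  rintro _ rfl
  refine (Timed.Sat.bind (t := 1) (u := 58 * N ^ 3) (Q := fun x => m = x)
    ⟨by simp, by simp⟩ ?_).mono (by omega) fun _ h => h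
  rintro _ rfl
  refine (Timed.Sat.bind (t := 1) (u := 57 * N ^ 3) (Q := fun x => x = n + 1)
    ⟨by simp; omega, by simp⟩ ?_).mono (by omega) fun _ h => h
  rintro _ rfl
  refine (Timed.Sat.bind (t := 1) (u := 56 * N ^ 3) (Q := fun x => n = x)
    ⟨by simp, by simp⟩ ?_).mono (by omega) fun _ h => h
  rintro _ rfl
  refine (Timed.Sat.bind (t := N + 1) (u := 54 * N ^ 3) (Q := fun _ => True)
    ⟨trivial, by rw [alloc_time]; omega⟩ fun M _ => ?_).mono (by omega) fun _ h => h
  refine (Timed.Sat.bind (t := N + 1) (u := 52 * N ^ 3) (Q := fun e => ∀ i, 0 ≤ e i)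
    ⟨by simp, by rw [allocV_time]; omega⟩ fun e he => ?_).mono (by omega) fun _ h => h
  refine (Timed.Sat.bind (t := 1) (u := 51 * N ^ 3) (Q := fun x => x = m - p)
    ⟨by simp, by simp⟩ ?_).mono (by omega) fun _ h => h
  rintro _ rfl
  refine (Timed.Sat.bind (t := 42 * N ^ 3) (u := 9 * N ^ 3)
    (Q := fun st : Option (Mat ℤ × Vec) => ∀ M e, st = some (M, e) → ∀ i, 0 ≤ e i) ?_
    fun out hout => ?_).mono (by omega) fun _ h => h
  · refine (forRange_sat (N := N) (c := 40) (k := 2) (fun _ (st : Option (Mat ℤ × Vec)) =>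
      ∀ M e, st = some (M, e) → ∀ i, 0 ≤ e i) hN (Nat.le_add_left _ _) (by omega)
      (by rintro _ _ ⟨⟩; exact he) fun i st hi hi' hst => ?_).mono le_rfl fun _ h => h
    rcases st with _ | ⟨M, e⟩
    · exact Timed.Sat.pure (by simp)
    replace hst := hst M e rfl
    -- The time bound holds in any case; only the sign of the new count needs d ≤ e, which is
    -- therefore a premise of the postcondition.
    have below : (leq (e i - (A i 1 - A (i + 1) 1)) (q : ℤ) >>= fun b =>
        if b = true then do
          let M ← fillRow (i + p) 1 (e i - (A i 1 - A (i + 1) 1)).toNat M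
          let PEnt ← wrV e (i + p) (e i - (A i 1 - A (i + 1) 1))
          pure (some (M, PEnt))
        else pure none).Sat (10 * N) fun st => A i 1 - A (i + 1) 1 ≤ e i →
          ∀ M e, st = some (M, e) → ∀ i, 0 ≤ e i := by
      simp only [Timed.Sat, bind_val, bind_time, leq_time, leq_val, ite_val, ite_time, wrV_val,
        wrV_time, pure_val, pure_time, decide_eq_true_eq]
      split_ifs with hle
      · have := fillRow_time (N := N) (i + p) (lo := 1)
          (hi := (e i - (A i 1 - A (i + 1) 1)).toNat) (by omega) M
        refine ⟨?_, by omega⟩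
        rintro hd _ _ ⟨⟩ r
        have := hst r
        dsimp only
        split_ifs <;> omega
      · exact ⟨by simp, by omega⟩
    have raise : ∀ c, (forRange 1 i (some (M, e)) fun i' (st : Option (Mat ℤ × Vec)) =>
          match st with
          | none => pure none
          | some (M, PEnt) => do
            if (← same (← res i' p) c) then
              let e' ← rdV PEnt i'
              let len ← add e' (A i 1 - A (i + 1) 1 - e i)
              if (← leq len (q : ℤ)) then
                let lo ← add e' 1
                let M ← fillRow i' lo.toNat len.toNat M
                let PEnt ← wrV PEnt i' len
                pure (some (M, PEnt))
              else pure none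
            else pure (some (M, PEnt))).Sat (17 * N ^ 2) fun st => e i ≤ A i 1 - A (i + 1) 1 →
              ∀ M e, st = some (M, e) → ∀ i, 0 ≤ e i := by
      intro c
      refine (forRange_sat (N := N) (c := 15) (k := 1) (fun _ (st : Option (Mat ℤ × Vec)) =>
        e i ≤ A i 1 - A (i + 1) 1 → ∀ M e, st = some (M, e) → ∀ i, 0 ≤ e i) hN
        (Nat.le_add_left _ _) (by omega) (by rintro _ _ _ ⟨⟩; exact hst)
        fun i' st _ _ hst' => ?_).mono le_rfl fun _ h => h
      rcases st with _ | ⟨M, e'⟩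
      · exact Timed.Sat.pure (by simp)
      replace hst' := fun hd => hst' hd M e' rfl
      simp only [Timed.Sat, bind_val, bind_time, same_val, same_time, res_time, ite_val, ite_time,
        rdV_time, add_time, leq_time, leq_val, wrV_val, wrV_time, pure_val, pure_time,
        decide_eq_true_eq, add_val, rdV_val, pow_one]
      split_ifs with h1 h2
      · have := fillRow_time (N := N) i' (lo := (e' i' + 1).toNat)
          (hi := (e' i' + (A i 1 - A (i + 1) 1 - e i)).toNat) (by omega) M
        refine ⟨?_, by omega⟩
        rintro hd _ _ ⟨⟩ r
        have := hst' hd r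
        have := hst' hd i'
        dsimp only
        split_ifs <;> omega
      · exact ⟨by simp, by omega⟩
      · refine ⟨?_, by omega⟩
        rintro hd _ _ ⟨⟩ r
        exact hst' hd r
    refine (Timed.Sat.bind (t := 1) (u := 39 * N ^ 2) (Q := fun x => A i 1 = x)
      ⟨rfl, le_rfl⟩ ?_).mono (by omega) fun _ h => h
    rintro _ rfl
    refine (Timed.Sat.bind (t := 1) (u := 38 * N ^ 2) (Q := fun x => i + 1 = x)
      ⟨rfl, le_rfl⟩ ?_).mono (by omega) fun _ h => h
    rintro _ rfl
    refine (Timed.Sat.bind (t := 1) (u := 37 * N ^ 2) (Q := fun x => A (i + 1) 1 = x)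
      ⟨rfl, le_rfl⟩ ?_).mono (by omega) fun _ h => h
    rintro _ rfl
    refine (Timed.Sat.bind (t := 1) (u := 36 * N ^ 2) (Q := fun x => e i = x)
      ⟨rfl, le_rfl⟩ ?_).mono (by omega) fun _ h => h
    rintro _ rfl
    refine (Timed.Sat.bind (t := 1) (u := 35 * N ^ 2) (Q := fun x => A i 1 - A (i + 1) 1 = x)
      ⟨rfl, le_rfl⟩ ?_).mono (by omega) fun _ h => h
    rintro _ rfl
    have below' : A i 1 - A (i + 1) 1 ≤ e i → Timed.Sat (do
        let r ← add i p
        let len ← sub (e i) (A i 1 - A (i + 1) 1)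
        if (← leq len (q : ℤ)) then
          let M ← fillRow r 1 len.toNat M
          let PEnt ← wrV e r len
          pure (some (M, PEnt))
        else pure none) (12 * N ^ 2) fun st => ∀ M e, st = some (M, e) → ∀ i, 0 ≤ e i := by
      intro hd
      refine (Timed.Sat.bind (t := 1) (u := 11 * N ^ 2) (Q := fun x => i + p = x)
        ⟨rfl, le_rfl⟩ ?_).mono (by omega) fun _ h => h
      rintro _ rfl
      refine (Timed.Sat.bind (t := 1) (u := 10 * N ^ 2)
        (Q := fun x => e i - (A i 1 - A (i + 1) 1) = x) ⟨rfl, le_rfl⟩ ?_).mono (by omega) fun _ h => h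
      rintro _ rfl
      exact below.mono (by omega) fun _ h => h hd
    refine (Timed.Sat.bind (t := 1) (u := 34 * N ^ 2) (Q := fun b => b = true → A i 1 ≤ A (i + 1) 1)
      ⟨by simp, le_rfl⟩ fun b1 hb1 => ?_).mono (by omega) fun _ h => h
    split_ifs with h1
    -- Here d ≤ 0 ≤ e, so this branch is also a case of d ≤ e.
    · exact (below' (by have := hst i; have := hb1 h1; omega)).mono (by omega) fun _ h => h
    refine (Timed.Sat.bind (t := 1) (u := 33 * N ^ 2)
      (Q := fun b => b = true ↔ A i 1 - A (i + 1) 1 ≤ e i)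
      ⟨by simp, le_rfl⟩ fun b2 hb2 => ?_).mono (by omega) fun _ h => h
    split_ifs with h2
    · exact (below' (hb2.1 h2)).mono (by omega) fun _ h => h
    refine (Timed.Sat.bind (t := 1) (u := 32 * N ^ 2)
      (Q := fun x => A i 1 - A (i + 1) 1 - e i = x) ⟨rfl, le_rfl⟩ ?_).mono (by omega) fun _ h => h
    rintro _ rfl
    refine (Timed.Sat.bind (t := 3) (u := 17 * N ^ 2) (Q := fun _ => True)
      ⟨trivial, by simp⟩ fun c _ => ?_).mono (by omega) fun _ h => h
    exact (raise c).mono le_rfl fun _ h => h (by have := mt hb2.2 h2; omega)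
  · rcases out with _ | ⟨M, e⟩
    · exact Timed.Sat.pure (by simp)
    replace hout := hout M e rfl
    refine (Timed.Sat.bind (t := 1) (u := 8 * N ^ 3) (Q := fun x => x = A 1 1)
      ⟨rfl, le_rfl⟩ ?_).mono (by omega) fun _ h => h
    rintro _ rfl
    refine ((forRange_sat (N := N) (c := 2) (k := 0) (fun _ (x : ℤ) => x ≤ K) hN
      (Nat.le_add_left _ _) (by omega) hA fun i x _ _ hx => ⟨?_, by simp⟩).bind (u := 1)
      fun k hk => ⟨?_, ?_⟩).mono (by norm_num; omega) fun _ h => h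
    · have := hout i
      simp only [bind_val, rdV_val, sub_val]
      omega
    · intro M' e' k' hk'
      simp only [bind_val, ite_val, pure_val] at hk'
      split_ifs at hk'
      simp only [Option.some.injEq, Prod.mk.injEq] at hk'
      rw [← hk'.2.2]
      exact hk
    · simp

end ConstRows

/-! ### Windows of symbols and the solutions of the smooth part -/

section Smooth
variable {N m n p q : ℕ} {K : ℕ}

theorem transpose_sat {h w : ℕ} {A : Mat ℤ} (hN : 1 ≤ N) (hh : h ≤ N) (hw : w ≤ N)
    (hhw : h * w ≤ N) (hA : A 1 1 ≤ K) :
    (transpose h w A).Sat (10 * N ^ 2) fun B => B 1 1 ≤ K := by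
  have h4 := le_pow_two N
  refine (Timed.Sat.bind (t := N + 1) (u := 6 * N ^ 2) (Q := fun B : Mat ℤ => B 1 1 ≤ (K : ℤ))
    ⟨by simp, by rw [alloc_time, Nat.mul_comm]; omega⟩ fun B hB => ?_).mono (by omega) fun _ h => h
  refine (forRange_sat (N := N) (c := 4) (k := 1) (fun _ (B : Mat ℤ) => B 1 1 ≤ K) hN
    (Nat.le_add_left _ _) (by omega) hB fun i B _ _ hB => ?_).mono le_rfl fun _ h => h
  refine (forRange_sat (N := N) (c := 2) (k := 0) (fun _ (B : Mat ℤ) => B 1 1 ≤ K) hN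
    (Nat.le_add_left _ _) (by omega) hB fun j B _ _ hB => ⟨?_, by simp⟩).mono le_rfl fun _ h => h
  simp only [bind_val, rd_val, wr_val]
  split_ifs with h
  · rw [← h.1, ← h.2] at *; exact hA
  · exact hB

theorem recConstCols₁_sat (h : Sizes N m n p q) {A : Mat ℤ} (hA : A 1 1 ≤ K) :
    (recConstCols₁ (m - p + 1) (n - q + 1) p q A).Sat (70 * N ^ 3) fun out =>
      ∀ M f k, out = some (M, f, k) → k ≤ K := by
  have h3 : N ^ 2 ≤ N ^ 3 := Nat.pow_le_pow_right h.pos (by norm_num)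
  have h0 := h.rows
  have h1 := h.cols
  have hp := h.hp
  have hq := h.hq
  have hpm := h.hpm
  have hqn := h.hqn
  refine ((transpose_sat h.pos (by omega) (by omega) h.scan hA).bind fun B hB =>
    recConstRows₁_sat h.swap hB).mono (by omega) fun _ h => h

theorem classMax_time {l : ℕ} (hN : 1 ≤ N) (hl : l ≤ N) (hp : p ≤ N) (v : Vec) :
    (classMax l p v).time ≤ 12 * N := by
  have := forRange_time_const (N := N) (c := 8) (lo := 1) (hi := l) (s := ((fun _ => (0 : ℤ)) : Vec))
    (body := fun i w => do
    let r ← res i p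
    let x ← rdV v i
    if (← leq x (← rdV w r)) then pure w else wrV w r x) hN (by omega) fun i w => by
      simp only [bind_time, res_time, rdV_time, leq_time, ite_time, wrV_time, pure_time]
      split_ifs <;> omega
  rw [classMax, bind_time]
  refine (Nat.add_le_add_left this _).trans ?_
  rw [allocV_time]
  omega

theorem alphabet_sat {krow kcol : ℕ} (hN : 1 ≤ N) (hr : krow ≤ N) (hc : kcol ≤ N) :
    (alphabet krow kcol).Sat (9 * N) fun S => S.length = krow + kcol + 3 := by
  rw [alphabet]
  refine (Timed.Sat.bind (t := 1) (u := 8 * N) (Q := fun L => List.length L = 1)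
    ⟨rfl, le_rfl⟩ fun L hL => ?_).mono (by omega) fun _ h => h
  refine (Timed.Sat.bind (t := 1) (u := 7 * N) (Q := fun L => List.length L = 2)
    ⟨by simp [hL], le_rfl⟩ fun L hL => ?_).mono (by omega) fun _ h => h
  refine (Timed.Sat.bind (t := 1) (u := 6 * N) (Q := fun L => List.length L = 3)
    ⟨by simp [hL], le_rfl⟩ fun L hL => ?_).mono (by omega) fun _ h => h
  refine ((forRange_sat (N := N) (c := 1) (k := 0) (fun k (L : List Cell) => L.length = k + 2) hN
    (Nat.le_add_left _ _) (by omega) (by omega) fun k L _ _ hL => ⟨by simp [hL],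
    by simp⟩).bind fun L hL => (forRange_sat (N := N) (c := 1) (k := 0)
    (fun k (L : List Cell) => L.length = kcol + k + 2) hN (Nat.le_add_left _ _) (by omega)
    (by omega) fun k L _ _ hL => ⟨by simp [hL]; omega, by simp⟩)).mono (by norm_num; omega)
    fun _ h => by omega

theorem windows_step_val (i j : ℕ) (S : List Cell) (L : List (Mat Cell)) :
    (forEach L [] fun W acc => forEach S acc fun s acc => do
      let W ← copy p q W
      push acc (← wr W i j s)).val =
    L.flatMap fun W => S.flatMap fun s => [(wr W i j s).val] := by
  rw [forEach_append_val fun W => S.flatMap fun s => [(wr W i j s).val], List.nil_append]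
  intro W acc
  apply forEach_append_val
  intro s acc
  simp

/-- Each cell multiplies the number of partial windows by the alphabet size. The cost is measured
against a bound W that stays the same for all cells. -/
theorem windows_step_sat (h : Sizes N m n p q) (i j : ℕ) {S : List Cell} {L : List (Mat Cell)}
    {W e : ℕ} (hS : S.length ≤ 5 * N) (hL : L.length = S.length ^ e) (hW : S.length ^ e ≤ W)
    (hW1 : 1 ≤ W) :
    (forEach L [] fun W acc => forEach S acc fun s acc => do
      let W ← copy p q W
      push acc (← wr W i j s)).Sat (40 * W * N ^ 2) fun L' => L'.length = S.length ^ (e + 1) := by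
  have hN := h.pos
  have h1 := h.window
  have h4 := le_pow_two N
  have h5 : 1 ≤ N ^ 2 := Nat.one_le_pow _ _ hN
  have h6 : 1 ≤ W * N ^ 2 := Nat.mul_pos hW1 h5
  constructor
  · rw [windows_step_val]
    simp only [List.length_flatMap, List.length_singleton, List.map_const', List.sum_replicate,
      smul_eq_mul, mul_one, hL, pow_succ]
  · refine (forEach_time (t := 30 * N ^ 2) fun M acc => ?_).trans ?_
    · refine (forEach_time (t := 4 * N) fun s acc => ?_).trans ?_
      · simp only [bind_time, copy_time, wr_time, push_time]
        omega
      · calc S.length * (4 * N + 1) + 1 ≤ (5 * N) * (4 * N + N) + N ^ 2 := by gcongr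
          _ = 26 * N ^ 2 := by ring
          _ ≤ _ := by omega
    · calc L.length * (30 * N ^ 2 + 1) + 1 ≤ W * (30 * N ^ 2 + N ^ 2) + W * N ^ 2 := by
            gcongr; omega
        _ = 32 * W * N ^ 2 := by ring
        _ ≤ _ := by gcongr; omega

/-- The alphabet is bounded twice: by s, to be independent of N, which controls the number of
windows, and by 5N, which controls the cost of a single round. -/
theorem allWindows_sat (h : Sizes N m n p q) {S : List Cell} {s : ℕ} (hS1 : 1 ≤ S.length)
    (hS : S.length ≤ 5 * N) (hs : S.length ≤ s) :
    (allWindows p q S).Sat (60 * (s ^ (p * q) * N ^ 4)) fun L => L.length ≤ s ^ (p * q) := by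
  have hN := h.pos
  have h0 := h.rows
  have h1 := h.cols
  have hp := h.hp
  have hq := h.hq
  have hpm := h.hpm
  have hqn := h.hqn
  have hw := h.window
  set W := s ^ (p * q) with hWdef
  have hW : ∀ e, e ≤ p * q → S.length ^ e ≤ W := fun e he =>
    (Nat.pow_le_pow_right hS1 he).trans (Nat.pow_le_pow_left hs _)
  have hW1 : 1 ≤ W := hW 0 (Nat.zero_le _)
  have h4 : N ≤ N ^ 4 := Nat.le_self_pow (by norm_num) N
  have h5 : N ^ 4 ≤ W * N ^ 4 := Nat.le_mul_of_pos_left _ hW1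
  rw [allWindows]
  refine (Timed.Sat.bind (t := N + 1) (u := 58 * (W * N ^ 4)) (Q := fun _ => True)
    ⟨trivial, by rw [alloc_time]; omega⟩ fun Z _ => ?_).mono (by omega) fun _ h => h
  refine (Timed.Sat.bind (t := 1) (u := 57 * (W * N ^ 4)) (Q := fun L => List.length L = 1)
    ⟨rfl, le_rfl⟩ fun L hL => ?_).mono (by omega) fun _ h => h
  refine (forRange_sat (N := N) (c := 40 * W + 2) (k := 3)
    -- Before row i exactly (i - 1)q cells have been assigned.
    (fun i (L : List (Mat Cell)) => L.length = S.length ^ ((i - 1) * q)) hN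
    (Nat.le_add_left _ _) (by omega) (by simpa using hL) fun i L hi hi' hL => ?_).mono ?_
    fun L hL => ?_
  · refine (forRange_sat (N := N) (c := 40 * W) (k := 2)
      (fun j (L : List (Mat Cell)) => L.length = S.length ^ ((i - 1) * q + (j - 1))) hN
      (Nat.le_add_left _ _) (by omega) (by simpa using hL) fun j L hj hj' hL => ?_).mono le_rfl
      fun L hL => ?_
    · have hle : (i - 1) * q + (j - 1) ≤ p * q := by
        calc (i - 1) * q + (j - 1) ≤ (i - 1) * q + q := by omega
          _ = (i - 1 + 1) * q := by ring
          _ ≤ p * q := Nat.mul_le_mul_right _ (by omega)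
      refine (windows_step_sat h i j hS hL (hW _ hle) hW1).mono le_rfl fun L hL => ?_
      rw [hL]
      congr 1
      omega
    · rw [hL]
      congr 1
      obtain ⟨i, rfl⟩ : ∃ k, i = k + 1 := ⟨i - 1, by omega⟩
      simp only [Nat.add_sub_cancel, Nat.add_mul, Nat.one_mul]
  · calc (40 * W + 2 + 2) * N ^ (3 + 1) = 40 * (W * N ^ 4) + 4 * N ^ 4 := by ring
      _ ≤ _ := by omega
  · rw [hL]
    exact hW _ (by simp)

theorem rowCountsOK_time (hN : 1 ≤ N) (hp : p ≤ N) (hq : q ≤ N) (v : Vec) (W : Mat Cell) :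
    (rowCountsOK p q v W).time ≤ 9 * N ^ 2 := by
  refine forRange_time_linear (c := 7) hN (by omega) fun i ok => ?_
  have := forRange_time_const (N := N) (c := 3) (lo := 1) (hi := q) (s := (0 : ℤ))
    (body := fun j c => do
      if (← same (← rd W i j) Cell.Q) then add c 1 else pure c) hN (by omega) fun j c => by
      simp only [bind_time, rd_time, same_time, ite_time, add_time, pure_time]
      split_ifs <;> omega
  rw [bind_time]
  simp only [bind_time, rdV_time, same_time, ite_time, pure_time, ite_self] at this ⊢
  omega

theorem colCountsOK_time (hN : 1 ≤ N) (hp : p ≤ N) (hq : q ≤ N) (v : Vec) (W : Mat Cell) :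
    (colCountsOK p q v W).time ≤ 9 * N ^ 2 := by
  refine forRange_time_linear (c := 7) hN (by omega) fun j ok => ?_
  have := forRange_time_const (N := N) (c := 3) (lo := 1) (hi := p) (s := (0 : ℤ))
    (body := fun i c => do
      if (← same (← rd W i j) Cell.P) then add c 1 else pure c) hN (by omega) fun j c => by
      simp only [bind_time, rd_time, same_time, ite_time, add_time, pure_time]
      split_ifs <;> omega
  rw [bind_time]
  simp only [bind_time, rdV_time, same_time, ite_time, pure_time, ite_self] at this ⊢
  omega

theorem inOneColumn_time (hN : 1 ≤ N) (hp : p ≤ N) (hq : q ≤ N) (s : Cell) (W : Mat Cell) :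
    (inOneColumn p q s W).time ≤ 9 * N ^ 2 := by
  have := forRange_time_linear (N := N) (c := 6) (lo := 1) (hi := p) (s := ((0 : ℕ), true))
    (body := fun i st => forRange 1 q st fun j st => do
      if (← same (← rd W i j) s) then
        if (← same st.1 0) then pure (j, st.2)
        else if (← same st.1 j) then pure st
        else pure (st.1, false)
      else pure st) hN (by omega) fun i st =>
    forRange_time_const (c := 4) hN (by omega) fun j st => by
      simp only [bind_time, rd_time, same_time, ite_time, pure_time, ite_self]
      split_ifs <;> omega
  have h5 : 1 ≤ N ^ 2 := Nat.one_le_pow _ _ hN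
  rw [inOneColumn, bind_time]
  refine (Nat.add_le_add_right this _).trans ?_
  simp only [bind_time, same_time, ite_time, pure_time, ite_self]
  omega

theorem inOneRow_time (hN : 1 ≤ N) (hp : p ≤ N) (hq : q ≤ N) (s : Cell) (W : Mat Cell) :
    (inOneRow p q s W).time ≤ 9 * N ^ 2 := by
  have := forRange_time_linear (N := N) (c := 6) (lo := 1) (hi := p) (s := ((0 : ℕ), true))
    (body := fun i st => forRange 1 q st fun j st => do
      if (← same (← rd W i j) s) then
        if (← same st.1 0) then pure (i, st.2)
        else if (← same st.1 i) then pure st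
        else pure (st.1, false)
      else pure st) hN (by omega) fun i st =>
    forRange_time_const (c := 4) hN (by omega) fun j st => by
      simp only [bind_time, rd_time, same_time, ite_time, pure_time, ite_self]
      split_ifs <;> omega
  have h5 : 1 ≤ N ^ 2 := Nat.one_le_pow _ _ hN
  rw [inOneRow, bind_time]
  refine (Nat.add_le_add_right this _).trans ?_
  simp only [bind_time, same_time, ite_time, pure_time, ite_self]
  omega

theorem admissible_time {krow kcol : ℕ} (hN : 1 ≤ N) (hp : p ≤ N) (hq : q ≤ N) (hr : krow ≤ N)
    (hc : kcol ≤ N) (u v : Vec) (W : Mat Cell) :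
    (admissible p q krow kcol u v W).time ≤ 50 * N ^ 3 := by
  have h3 : N ^ 2 ≤ N ^ 3 := Nat.pow_le_pow_right hN (by norm_num)
  have t1 := rowCountsOK_time hN hp hq u W
  have t2 := colCountsOK_time hN hp hq v W
  have t3 := fun b => forRange_time_le (N := N) (c := 9) (k := 2) (lo := 1) (hi := kcol) (s := b)
    (body := fun k ok => do
      if (← inOneColumn p q (Cell.oneP k) W) then pure ok else pure false) hN (by omega)
    fun k ok => by
      simpa only [bind_time, ite_time, pure_time, ite_self, add_zero] using
        inOneColumn_time hN hp hq (Cell.oneP k) W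
  have t4 := fun b => forRange_time_le (N := N) (c := 9) (k := 2) (lo := 1) (hi := krow) (s := b)
    (body := fun k ok => do
      if (← inOneRow p q (Cell.oneQ k) W) then pure ok else pure false) hN (by omega)
    fun k ok => by
      simpa only [bind_time, ite_time, pure_time, ite_self, add_zero] using
        inOneRow_time hN hp hq (Cell.oneQ k) W
  simp only [Nat.reduceAdd] at t3 t4
  rw [admissible, bind_time, ite_time, bind_time, ite_time, bind_time]
  have t3' := t3 true
  have t4' := t4 (forRange 1 kcol true fun k ok => do
      if (← inOneColumn p q (Cell.oneP k) W) then pure ok else pure false).val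
  simp only [pure_time] at *
  split_ifs <;> omega

theorem bind_time_le {α β : Type} {x : Timed α} {f : α → Timed β} {t u : ℕ} (hx : x.time ≤ t)
    (hf : ∀ a, (f a).time ≤ u) : (x >>= f).time ≤ t + u :=
  Nat.add_le_add hx (hf _)

theorem expand_time (h : Sizes N m n p q) (u v : Vec) (W : Mat Cell) :
    (expand m n p q u v W).time ≤ 80 * N ^ 2 := by
  have hN := h.pos
  have h0 := h.rows
  have h1 := h.cols
  have hpm := h.hpm
  have hqn := h.hqn
  have hmn := h.hmn
  have h4 := le_pow_two N
  rw [expand]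
  refine (bind_time_le (t := N + 1) (u := 78 * N ^ 2) (by rw [alloc_time]; omega)
    fun Z => ?_).trans (by omega)
  refine (bind_time_le (t := N + 1) (u := 76 * N ^ 2) (by rw [copyV_time]; omega)
    fun u => ?_).trans (by omega)
  refine (bind_time_le (t := N + 1) (u := 74 * N ^ 2) (by rw [copyV_time]; omega)
    fun v => ?_).trans (by omega)
  refine (bind_time_le (t := 14 * N ^ 2) (u := 60 * N ^ 2) ?_ fun st => ?_).trans (by omega)
  · refine forRange_time_linear (c := 12) hN (by omega) fun i st =>
      forRange_time_const (c := 10) hN (by omega) fun j st => ?_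
    simp only [bind_time, rdV_time, rd_time, res_time, same_time, ite_time, sub_time, wr_time,
      wrV_time, pure_time]
    split_ifs <;> omega
  refine (bind_time_le (t := 14 * N ^ 2) (u := 46 * N ^ 2) ?_ fun st => ?_).trans (by omega)
  · refine forRange_time_linear (c := 12) hN (by omega) fun i st =>
      forRange_time_const (c := 10) hN (by omega) fun j st => ?_
    simp only [bind_time, rdV_time, rd_time, res_time, same_time, ite_time, sub_time, wr_time,
      wrV_time, pure_time]
    split_ifs <;> omega
  refine (bind_time_le (t := 6 * N ^ 2) (u := 40 * N ^ 2) ?_ fun C => ?_).trans (by omega)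
  · refine forRange_time_linear (c := 4) hN (by omega) fun i st =>
      forRange_time_const (c := 2) hN (by omega) fun j st => ?_
    rw [bind_time, rd_time]
    cases (rd W i j).val <;> simp
  refine (forRange_time_linear (c := 16) hN (by omega) fun i C =>
      forRange_time_const (c := 14) hN (by omega) fun j C => ?_).trans (by omega)
  simp only [bind_time, rd_time, res_time, same_time, ite_time, wr_time]
  cases (rd C (res i p).val (res j q).val).val <;> simp only [wr_time, pure_time] <;>
    split_ifs <;> omega

theorem forEach_sat_length {α β : Type} {t w : ℕ} {L : List α} {s : List β}
    {body : α → List β → Timed (List β)}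
    (hb : ∀ x ∈ L, ∀ s, (body x s).Sat t fun s' => s'.length ≤ s.length + w) :
    (forEach L s body).Sat (L.length * (t + 1) + 1)
      fun s' => s'.length ≤ s.length + L.length * w := by
  refine ⟨?_, forEach_time_inv (fun _ => True) trivial fun x hx s _ => ⟨trivial, (hb x hx s).2⟩⟩
  induction L generalizing s with
  | nil => simp [forEach]
  | cons x xs ih =>
    have h1 := (hb x (by simp) s).1
    have h2 := ih (s := (body x s).val) fun y hy => hb y (by simp [hy])
    simp only [forEach, bind_val, List.length_cons, Nat.add_mul, Nat.one_mul]
    omega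

/-- The part of `recSmoothAll` that treats one decomposition. -/
theorem recSmooth_step_sat (h : Sizes N m n p q) {AA : Mat ℤ × Mat ℤ}
    (hR : AA.1 1 1 ≤ (p * q : ℕ)) (hC : AA.2 1 1 ≤ (p * q : ℕ)) (acc : List (Mat Cell)) :
    Timed.Sat (do
      match (← recConstRows₁ (m - p + 1) (n - q + 1) p q AA.1) with
      | none => pure acc
      | some (_, rowEnt, krow) =>
        match (← recConstCols₁ (m - p + 1) (n - q + 1) p q AA.2) with
        | none => pure acc
        | some (_, colEnt, kcol) => do
          let rowMax ← classMax m p rowEnt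
          let colMax ← classMax n q colEnt
          let S ← alphabet krow.toNat kcol.toNat
          let Ws ← allWindows p q S
          forEach Ws acc fun W acc => do
            if (← admissible p q krow.toNat kcol.toNat rowMax colMax W) then
              push acc (← expand m n p q rowEnt colEnt W)
            else pure acc)
      (600 * ((2 * (p * q) + 3) ^ (p * q) * N ^ 4))
      fun L => L.length ≤ acc.length + (2 * (p * q) + 3) ^ (p * q) := by
  have hN := h.pos
  have h0 := h.rows
  have h1 := h.cols
  have hp := h.hp
  have hq := h.hq
  have hpm := h.hpm
  have hqn := h.hqn
  have hw := h.window
  set W := (2 * (p * q) + 3) ^ (p * q) with hWdef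
  have hW1 : 1 ≤ W := Nat.pow_pos (by omega)
  have e0 : N ^ 4 ≤ W * N ^ 4 := Nat.le_mul_of_pos_left _ hW1
  have e1 : N ≤ N ^ 4 := Nat.le_self_pow (by norm_num) N
  have e2 : N ^ 2 ≤ N ^ 3 := Nat.pow_le_pow_right hN (by norm_num)
  have e3 : N ^ 3 ≤ N ^ 4 := Nat.pow_le_pow_right hN (by norm_num)
  refine ((recConstRows₁_sat h hR).bind (u := 540 * (W * N ^ 4)) fun out hout => ?_).mono
    (by omega) fun _ h => h
  rcases out with _ | ⟨M, e, krow⟩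
  · exact Timed.Sat.pure (by omega)
  have hkr := hout M e krow rfl
  refine ((recConstCols₁_sat h hC).bind (u := 470 * (W * N ^ 4)) fun out hout => ?_).mono
    (by omega) fun _ h => h
  rcases out with _ | ⟨M', f, kcol⟩
  · exact Timed.Sat.pure (by omega)
  have hkc := hout M' f kcol rfl
  refine (Timed.Sat.bind (t := 12 * N) (u := 458 * (W * N ^ 4)) (Q := fun _ => True)
    ⟨trivial, classMax_time hN h0 (by omega) e⟩ fun rowMax _ => ?_).mono (by omega) fun _ h => h
  refine (Timed.Sat.bind (t := 12 * N) (u := 446 * (W * N ^ 4)) (Q := fun _ => True)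
    ⟨trivial, classMax_time hN h1 (by omega) f⟩ fun colMax _ => ?_).mono (by omega) fun _ h => h
  refine ((alphabet_sat hN (krow := krow.toNat) (kcol := kcol.toNat) (by omega) (by omega)).bind
    (u := 437 * (W * N ^ 4)) fun S hS => ?_).mono (by omega) fun _ h => h
  -- The alphabet consists of 0, P, Q and at most pq symbols of each of the kinds 1_P and 1_Q; also
  -- 2pq + 3 ≤ 5N.
  refine ((allWindows_sat h (S := S) (s := 2 * (p * q) + 3) (by omega) (by omega)
    (by omega)).bind (u := 377 * (W * N ^ 4)) fun Ws hWs => ?_).mono (by rw [← hWdef]; omega)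
    fun _ h => h
  refine (forEach_sat_length (t := 140 * N ^ 3) (w := 1) fun Z _ acc => ?_).mono ?_
    fun L hL => by omega
  · have t1 := admissible_time (p := p) (q := q) (krow := krow.toNat) (kcol := kcol.toNat) hN
      (by omega) (by omega) (by omega) (by omega) rowMax colMax Z
    have t2 := expand_time h e f Z
    have e4 : 1 ≤ N ^ 2 := Nat.one_le_pow _ _ hN
    simp only [Timed.Sat, bind_val, bind_time, ite_val, ite_time, push_val, push_time, pure_val,
      pure_time]
    split_ifs
    · exact ⟨by simp, by omega⟩
    · exact ⟨by omega, by omega⟩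
  · have e4 : 1 ≤ N ^ 3 := Nat.one_le_pow _ _ hN
    calc Ws.length * (140 * N ^ 3 + 1) + 1 ≤ W * (140 * N ^ 3 + N ^ 3) + W * N ^ 4 := by
          gcongr; exact e4.trans (e3.trans e0)
      _ = 141 * (W * N ^ 3) + W * N ^ 4 := by ring
      _ ≤ 141 * (W * N ^ 4) + W * N ^ 4 := by gcongr
      _ ≤ _ := by omega

/-- At most 2N decompositions, each contributing at most W matrices at cost O(W N^4). -/
theorem recSmoothAll_sat (h : Sizes N m n p q) {A : Mat ℤ} (hA : A 1 1 ≤ (p * q : ℕ)) :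
    (recSmoothAll (m - p + 1) (n - q + 1) p q A).Sat
      (2000 * ((2 * (p * q) + 3) ^ (p * q) * N ^ 5))
      fun L => L.length ≤ 2 * N * (2 * (p * q) + 3) ^ (p * q) := by
  have hN := h.pos
  have h0 := h.rows
  have h1 := h.cols
  have hp := h.hp
  have hq := h.hq
  have hpm := h.hpm
  have hqn := h.hqn
  have hmn := h.hmn
  have hw := h.window
  set W := (2 * (p * q) + 3) ^ (p * q) with hWdef
  have hW1 : 1 ≤ W := Nat.pow_pos (by omega)
  have h5 : N ^ 5 ≤ W * N ^ 5 := Nat.le_mul_of_pos_left _ hW1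
  have h4 : N ^ 4 ≤ W * N ^ 4 := Nat.le_mul_of_pos_left _ hW1
  have e1 : N ≤ N ^ 4 := Nat.le_self_pow (by norm_num) N
  have e3 : N ^ 3 ≤ N ^ 4 := Nat.pow_le_pow_right hN (by norm_num)
  have e4 : N ^ 3 ≤ N ^ 5 := Nat.pow_le_pow_right hN (by norm_num)
  have e5 : N ≤ N ^ 5 := Nat.le_self_pow (by norm_num) N
  rw [recSmoothAll]
  refine (Timed.Sat.bind (t := 1) (u := 1999 * (W * N ^ 5)) (Q := fun x => x = m + 1)
    ⟨by simp; omega, by simp⟩ ?_).mono (by omega) fun _ h => h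
  rintro _ rfl
  refine (Timed.Sat.bind (t := 1) (u := 1998 * (W * N ^ 5)) (Q := fun x => m = x)
    ⟨by simp, by simp⟩ ?_).mono (by omega) fun _ h => h
  rintro _ rfl
  refine (Timed.Sat.bind (t := 1) (u := 1997 * (W * N ^ 5)) (Q := fun x => x = n + 1)
    ⟨by simp; omega, by simp⟩ ?_).mono (by omega) fun _ h => h
  rintro _ rfl
  refine (Timed.Sat.bind (t := 1) (u := 1996 * (W * N ^ 5)) (Q := fun x => n = x)
    ⟨by simp, by simp⟩ ?_).mono (by omega) fun _ h => h
  rintro _ rfl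
  refine ((decompose_sat hN (by omega) (by omega) h.scan hw hA).bind (u := 1896 * (W * N ^ 5))
    fun D hD => ?_).mono (by omega) fun _ h => h
  refine (forEach_sat_length (t := 600 * (W * N ^ 4)) (w := W) fun AA hAA acc =>
    recSmooth_step_sat h (hD.2 AA hAA).1 (hD.2 AA hAA).2 acc).mono ?_ fun L hL => ?_
  · have e6 : 1 ≤ W * N ^ 4 := Nat.mul_pos hW1 (Nat.pow_pos hN)
    have e7 : 1 ≤ W * N ^ 5 := Nat.mul_pos hW1 (Nat.pow_pos hN)
    calc D.length * (600 * (W * N ^ 4) + 1) + 1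
        ≤ (2 * N) * (600 * (W * N ^ 4) + W * N ^ 4) + W * N ^ 5 := by gcongr; exact hD.1
      _ = 1203 * (W * N ^ 5) := by ring
      _ ≤ _ := by omega
  · rw [List.length_nil, Nat.zero_add] at hL
    exact hL.trans (Nat.mul_le_mul_right _ hD.1)

end Smooth

/-! ### Total running time -/

theorem toMat_le {h w : ℕ} {K : ℤ} (hK : 0 ≤ K) {A : Matrix (Fin h) (Fin w) ℤ}
    (hA : ∀ i j, A i j ≤ K) (i j : ℕ) : toMat A i j ≤ K := by
  unfold toMat
  split_ifs
  · exact hA _ _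
  · exact hK

/-- There are at most S = (2N)^(pq) sums. For each, the smooth part costs O(W N^5), while merging
with its at most 2NW solutions costs O(W N^4). -/
theorem reconstruction_time {N m n p q : ℕ} (h : Sizes N m n p q) {A : Mat ℤ}
    (hA : ∀ i j, A i j ≤ (p * q : ℕ)) :
    (reconstruction (m - p + 1) (n - q + 1) p q A).time ≤
      5000 * ((2 * N) ^ (p * q) * (2 * (p * q) + 3) ^ (p * q) * N ^ 6) := by
  have hN := h.pos
  have h0 := h.rows
  have h1 := h.cols
  have hp := h.hp
  have hq := h.hq
  have hpm := h.hpm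
  have hqn := h.hqn
  set W := (2 * (p * q) + 3) ^ (p * q) with hWdef
  set S := (2 * N) ^ (p * q) with hSdef
  have hW1 : 1 ≤ W := Nat.pow_pos (by omega)
  have hS1 : 1 ≤ S := Nat.pow_pos (by omega)
  have hSW : 1 ≤ S * W := Nat.mul_pos hS1 hW1
  have e0 : N ^ 6 ≤ S * W * N ^ 6 := Nat.le_mul_of_pos_left _ hSW
  have e1 : 1 ≤ N ^ 6 := Nat.one_le_pow _ _ hN
  have e2 : N ^ 2 ≤ N ^ 6 := Nat.pow_le_pow_right hN (by norm_num)
  have e3 : S * N ^ 4 ≤ S * W * N ^ 6 := Nat.mul_le_mul (Nat.le_mul_of_pos_right _ hW1)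
    (Nat.pow_le_pow_right hN (by norm_num))
  suffices hs : (reconstruction (m - p + 1) (n - q + 1) p q A).Sat (5000 * (S * W * N ^ 6))
      fun _ => True from hs.2
  rw [reconstruction]
  refine (Timed.Sat.bind (t := 1) (u := 4999 * (S * W * N ^ 6)) (Q := fun x => x = m + 1)
    ⟨by simp; omega, by simp⟩ ?_).mono (by omega) fun _ h => h
  rintro _ rfl
  refine (Timed.Sat.bind (t := 1) (u := 4998 * (S * W * N ^ 6)) (Q := fun x => m = x)
    ⟨by simp, by simp⟩ ?_).mono (by omega) fun _ h => h
  rintro _ rfl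
  refine (Timed.Sat.bind (t := 1) (u := 4997 * (S * W * N ^ 6)) (Q := fun x => x = n + 1)
    ⟨by simp; omega, by simp⟩ ?_).mono (by omega) fun _ h => h
  rintro _ rfl
  refine (Timed.Sat.bind (t := 1) (u := 4996 * (S * W * N ^ 6)) (Q := fun x => n = x)
    ⟨by simp, by simp⟩ ?_).mono (by omega) fun _ h => h
  rintro _ rfl
  refine (Timed.Sat.bind (t := 20 * N ^ 2) (u := 4976 * (S * W * N ^ 6)) (Q := fun _ => True)
    ⟨trivial, chi_time hN (by omega) (by omega) h.scan⟩ fun X _ => ?_).mono (by omega) fun _ h => h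
  refine (Timed.Sat.bind (t := 1005 * N ^ 6) (u := 3971 * (S * W * N ^ 6))
    (Q := fun Ls => Ls.length = p * q ∧ ∀ L ∈ Ls, ShortNonneg (2 * N) L)
    ⟨allValuations_val h X, allValuations_time h X⟩ fun Ls hLs => ?_).mono (by omega) fun _ h => h
  refine (Timed.Sat.bind (t := 60 * (S * N ^ 4)) (u := 3911 * (S * W * N ^ 6))
    (allSums_spec h hLs.1 hLs.2) fun Ms hMs => ?_).mono (by omega) fun _ h => h
  refine ⟨trivial, (findFirst_time (t := 2200 * (W * N ^ 5)) fun M hM => ?_).trans ?_⟩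
  -- Nonnegativity of the sum M is what keeps the residual at most pq, and thereby the number of
  -- windows independent of N.
  · have hB := residual_le (m' := m - p + 1) (n' := n - q + 1) (p := p) (q := q)
      (Int.natCast_nonneg _) hA (hMs.2 M hM)
    have f1 : N ^ 5 ≤ W * N ^ 5 := Nat.le_mul_of_pos_left _ hW1
    have f2 : N ^ 4 ≤ N ^ 5 := Nat.pow_le_pow_right hN (by norm_num)
    have f3 : 1 ≤ N ^ 3 := Nat.one_le_pow _ _ hN
    have f4 : N ^ 4 ≤ W * N ^ 4 := Nat.le_mul_of_pos_left _ hW1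
    have f5 : W * N ^ 4 ≤ W * N ^ 5 := Nat.mul_le_mul_left _ f2
    have f6 : 1 ≤ N ^ 4 := Nat.one_le_pow _ _ hN
    refine Timed.Sat.mono (R := fun _ => True) (Q := fun _ => True) ?_ le_rfl
      (fun _ _ => trivial) |>.2
    refine (Timed.Sat.bind (t := 20 * N ^ 4) (u := 2180 * (W * N ^ 5))
      (Q := fun B : Mat ℤ => ∀ i j, B i j ≤ ((p * q : ℕ) : ℤ))
      ⟨hB, residual_time h (by omega) (by omega) h.scan A M⟩ fun B hB => ?_).mono (by omega)
      fun _ h => h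
    refine ((recSmoothAll_sat h (hB 1 1)).bind (u := 180 * (W * N ^ 5)) fun Cs hCs =>
      ⟨trivial, ?_⟩).mono (by rw [← hWdef]; omega) fun _ h => h
    refine (findFirst_time (t := 40 * N ^ 3) fun C _ => merge_time h M C).trans ?_
    calc Cs.length * (40 * N ^ 3 + 1) + 1
        ≤ (2 * N * W) * (40 * N ^ 3 + N ^ 3) + W * N ^ 4 := by
          gcongr; exact f6.trans f4
      _ = 83 * (W * N ^ 4) := by ring
      _ ≤ _ := by omega
  · have f1 : 1 ≤ W * N ^ 5 := Nat.mul_pos hW1 (Nat.pow_pos hN)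
    have f2 : S * W * N ^ 5 ≤ S * W * N ^ 6 :=
      Nat.mul_le_mul_left _ (Nat.pow_le_pow_right hN (by norm_num))
    calc Ms.length * (2200 * (W * N ^ 5) + 1) + 1
        ≤ S * (2200 * (W * N ^ 5) + W * N ^ 5) + S * W * N ^ 6 := by
          gcongr
          · exact hMs.1
          · exact e1.trans e0
      _ = 2201 * (S * W * N ^ 5) + S * W * N ^ 6 := by ring
      _ ≤ _ := by omega

end Microscope

theorem mainTheorem2 (p q : ℕ) (hp : 1 ≤ p) (hq : 1 ≤ q) :
    ∃ P : Polynomial ℕ, ∀ (m n : ℕ), p ≤ m → q ≤ n →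
      ∀ A : Matrix (Fin (m - p + 1)) (Fin (n - q + 1)) ℤ,
        (∀ i j, 0 ≤ A i j ∧ A i j ≤ (p * q : ℤ)) →
          (Microscope.reconstruction (m - p + 1) (n - q + 1) p q (Microscope.toMat A)).time
            ≤ P.eval (m * n) := by
  -- The bound for N = mn read as a polynomial in N, of degree pq + 6; the number of windows is a
  -- constant.
  refine ⟨5000 * ((2 * Polynomial.X) ^ (p * q) * Polynomial.C ((2 * (p * q) + 3) ^ (p * q)) *
    Polynomial.X ^ 6),
    fun m n hm hn A hA => ?_⟩
  refine (Microscope.reconstruction_time ⟨hp, hq, hm, hn, le_rfl⟩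
    (Microscope.toMat_le (by positivity) fun i j => ?_)).trans (le_of_eq ?_)
  · exact_mod_cast (hA i j).2
  · simp
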